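/- Let $G$ be a locally compact Hausdorff group with a (left) Haar measure $ds$, acting freely and properly on the right of a locally compact Hausdorff space $T$, and let $\mathrm{rt}$ be the action of $G$ on $C_0(T)$ given by $\mathrm{rt}_s(f)(t)=f(ts)$. Let $\alpha:G\to\operatorname{Aut}A$ be a strongly continuous action on a $C^*$-algebra $A$ and let $\phi:C_0(T)\to M(A)$ be a nondegenerate homomorphism with $\alpha_s(\phi(f))=\phi(\mathrm{rt}_s(f))$ for $s\in G$, $f\in C_0(T)$. Put $A_0:=\operatorname{span}\{\phi(f)a\phi(g):a\in A,\ f,g\in C_c(T)\}$. For each $a\in A_0$ there is a unique $E(a)\in M(A)$ such that $s\mapsto\omega(\alpha_s(a))$ is integrable and $\omega(E(a))=\int_G\omega(\alpha_s(a))\,ds$ for every $\omega\in A^*$ (where $\omega$ is extended to $M(A)$ by strict continuity), and the norm closure $A^\alpha=\operatorname{Fix}(A,\alpha,\phi):=\overline{E(A_0)}$ is a $C^*$-subalgebra of $M(A)$. Moreover: 1. $E(A_0)A_0\subset A_0$, and the products $E(a)b$ with $a,b\in A_0$ form a dense subset of $A_0$ in the norm of $A$. 2. The inclusion $\iota$ of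 $A^\alpha$ in $M(A)$ is nondegenerate: the linear span of $\{mb:m\in A^\alpha,\ b\in A\}$ is dense in $A$. 3. $\iota$ has a unique extension to a unital $*$-homomorphism $\overline\iota:M(A^\alpha)\to M(A)$. This extension is strictly continuous, and it is an isomorphism of $M(A^\alpha)$ onto $$\{m\in M(A): mA^\alpha\subset A^\alpha\ \text{and}\ A^\alpha m\subset A^\alpha\}.$$ -/

import Mathlib

open scoped MultiplierAlgebra ZeroAtInfty

noncomputable section

namespace FixedPoint

/-! ### Multiplier algebras

`𝓜(ℂ, A)` is the multiplier algebra `M(A)`, realised by double centralizers. For `m : 𝓜(ℂ, A)` and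
`a : A`, the element `m a` of `A` is `m.fst a` and the element `a m` of `A` is `m.snd a`. -/

section Multipliers

variable {A B : Type*} [NonUnitalCStarAlgebra A] [NonUnitalCStarAlgebra B]

/-- The strict topology on `M(A)`: the coarsest topology for which all the maps `m ↦ m a` and
`m ↦ a m` (`a ∈ A`) into `A` with its norm topology are continuous. -/
abbrev strictTopology (A : Type*) [NonUnitalCStarAlgebra A] : TopologicalSpace 𝓜(ℂ, A) :=
  TopologicalSpace.induced
    (fun m : 𝓜(ℂ, A) => ((fun a : A => m.fst a), (fun a : A => m.snd a))) inferInstance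

/-- `Ω` is the extension of `ω ∈ A^*` to a strictly continuous linear functional on `M(A)`.
(`A` is strictly dense in `M(A)`, so there is at most one; every `ω ∈ A^*` has one.) -/
def IsStrictExtension (ω : A →L[ℂ] ℂ) (Ω : 𝓜(ℂ, A) →ₗ[ℂ] ℂ) : Prop :=
  @Continuous _ _ (strictTopology A) _ Ω ∧ ∀ a : A, Ω (a : 𝓜(ℂ, A)) = ω a

/-- A `*`-homomorphism `σ : B → M(A)` is nondegenerate if the linear span of the elements
`σ(b) a` is dense in `A`. -/
def IsNondegenerate (σ : B →⋆ₙₐ[ℂ] 𝓜(ℂ, A)) : Prop :=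
  Dense (Submodule.span ℂ {x : A | ∃ (b : B) (a : A), x = (σ b).fst a} : Set A)

/-- A `*`-automorphism of `A` as a bounded linear operator. -/
def autCLM (σ : A ≃⋆ₐ[ℂ] A) : A →L[ℂ] A where
  toFun := σ
  map_add' := map_add σ
  map_smul' := map_smul σ
  cont := (NonUnitalStarAlgHom.isometry σ σ.injective).continuous

/-- The canonical extension of a `*`-automorphism `σ` of `A` to `M(A)`:
`σ(m) a = σ(m σ⁻¹(a))` and `a σ(m) = σ(σ⁻¹(a) m)`. -/
def extendAut (σ : A ≃⋆ₐ[ℂ] A) (m : 𝓜(ℂ, A)) : 𝓜(ℂ, A) where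
  fst := (autCLM σ).comp (m.fst.comp (autCLM σ.symm))
  snd := (autCLM σ).comp (m.snd.comp (autCLM σ.symm))
  central := fun x y => by
    have h := congrArg σ (m.central (σ.symm x) (σ.symm y))
    rw [map_mul, map_mul] at h
    simpa [autCLM] using h

end Multipliers

/-! ### Right translation on `C₀(T)` -/

section Translation

variable {G T : Type*} [Group G] [TopologicalSpace G] [TopologicalSpace T]
  [MulAction Gᵐᵒᵖ T] [ContinuousConstSMul Gᵐᵒᵖ T]

/-- The action of `G` on `C₀(T)` induced by a right action of `G` on `T` (that is, a left action
of the opposite group, `t · s = MulOpposite.op s • t`): `(rt s f)(t) = f(t · s)`. -/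
def rt (s : G) (f : C₀(T, ℂ)) : C₀(T, ℂ) :=
  f.comp (Homeomorph.smul (MulOpposite.op s) : T ≃ₜ T).toCocompactMap

end Translation

/-! ### The generalised fixed-point algebra -/

section Fix

variable {G T A : Type*} [Group G] [TopologicalSpace G] [MeasurableSpace G] [TopologicalSpace T]
  [NonUnitalCStarAlgebra A]

/-- `A₀ = span {φ(f) a φ(g) : a ∈ A, f, g ∈ C_c(T)}`. -/
def coreSubspace (φ : C₀(T, ℂ) →⋆ₙₐ[ℂ] 𝓜(ℂ, A)) : Submodule ℂ A :=
  Submodule.span ℂ {x : A | ∃ (f g : C₀(T, ℂ)) (a : A), HasCompactSupport f ∧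
    HasCompactSupport g ∧ x = (φ f).fst ((φ g).snd a)}

/-- `m ∈ M(A)` is the average `E(a)` of `a` over the action `α`: for every `ω ∈ A^*` the function
`s ↦ ω(α_s(a))` is integrable, and `ω(m) = ∫ ω(α_s(a)) ds`, where `ω` is extended to `M(A)` by
strict continuity. -/
def IsAverage (μ : MeasureTheory.Measure G) (α : G →* (A ≃⋆ₐ[ℂ] A)) (a : A) (m : 𝓜(ℂ, A)) :
    Prop :=
  ∀ ω : A →L[ℂ] ℂ, MeasureTheory.Integrable (fun s => ω (α s a)) μ ∧
    ∀ Ω : 𝓜(ℂ, A) →ₗ[ℂ] ℂ, IsStrictExtension ω Ω → Ω m = ∫ s, ω (α s a) ∂μ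

/-- The set `E(A₀)` of all averages of elements of `A₀`. -/
def averages (μ : MeasureTheory.Measure G) (α : G →* (A ≃⋆ₐ[ℂ] A))
    (φ : C₀(T, ℂ) →⋆ₙₐ[ℂ] 𝓜(ℂ, A)) : Set 𝓜(ℂ, A) :=
  {m | ∃ a ∈ coreSubspace φ, IsAverage μ α a m}

/-- `Fix(A, α, φ)` as a `C^*`-subalgebra of `M(A)`: the one generated by `E(A₀)`. (That it is
the norm closure of `E(A₀)` itself is not built in here.) -/
def fixAlgebra (μ : MeasureTheory.Measure G) (α : G →* (A ≃⋆ₐ[ℂ] A))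
    (φ : C₀(T, ℂ) →⋆ₙₐ[ℂ] 𝓜(ℂ, A)) : NonUnitalStarSubalgebra ℂ 𝓜(ℂ, A) :=
  (NonUnitalStarAlgebra.adjoin ℂ (averages μ α φ)).topologicalClosure

instance fixAlgebraNonUnitalCStarAlgebra (μ : MeasureTheory.Measure G)
    (α : G →* (A ≃⋆ₐ[ℂ] A)) (φ : C₀(T, ℂ) →⋆ₙₐ[ℂ] 𝓜(ℂ, A)) :
    NonUnitalCStarAlgebra (fixAlgebra μ α φ) where
  norm_mul_self_le x := CStarRing.norm_mul_self_le (x : 𝓜(ℂ, A))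
  toCompleteSpace := (NonUnitalStarSubalgebra.isClosed_topologicalClosure
    (NonUnitalStarAlgebra.adjoin ℂ (averages μ α φ))).completeSpace_coe

/-- The inclusion `ι` of `Fix(A, α, φ)` in `M(A)`. -/
def fixInclusion (μ : MeasureTheory.Measure G) (α : G →* (A ≃⋆ₐ[ℂ] A))
    (φ : C₀(T, ℂ) →⋆ₙₐ[ℂ] 𝓜(ℂ, A)) : fixAlgebra μ α φ →⋆ₙₐ[ℂ] 𝓜(ℂ, A) :=
  NonUnitalStarSubalgebraClass.subtype (fixAlgebra μ α φ)

end Fix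

end FixedPoint

end

noncomputable section

set_option linter.unusedSectionVars false

namespace FixedPoint

open Filter Topology MeasureTheory MulOpposite TopologicalSpace

/-! ### Multipliers -/

section MultiplierBasics

variable {A : Type*} [NonUnitalCStarAlgebra A]

/-! The difficulty is to make sense of `E(a) = ∫ α_s(a) ds`, since `s ↦ α_s(a)` need not be norm
integrable. Two facts replace norm integrability.

The first is a uniform bound. For `a ≥ 0` one has `0 ≤ φ(f) a φ(f)* ≤ ‖a‖ φ(f f*)`, so by
equivariance the integral of the orbit over a relatively compact set is dominated by `‖a‖ φ(∫ rt_s(f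
f*) ds)`. The inner integral is a bounded function, because the set of `s` with `t s` in a given
compact set has Haar measure bounded independently of `t`. Polarisation extends the bound to all of
`A₀` (`averageBounded_generator`).

The second is properness: if `g` has compact support, then `φ(g) α_s(a)` and `α_s(a) φ(g)` vanish
for `s` off a compact set. The integrals over compact sets are therefore eventually constant on a
dense subspace and, being bounded, converge strictly (`exists_isStrictAverage`).

Left invariance of the measure makes `E(a)` invariant under `α`, so `E(a) E(b) = E(E(a) b)`, and
`E(A₀)` is a `*`-algebra. For density, take `f` with `∫ f(t s)² ds = 1` on the support of `g`. Then
`E(φ(f) e φ(f)) φ(g) c` is an integral that equals `φ(g) c` once `e` is deleted, so letting `e` run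
through an approximate unit gives convergence to `φ(g) c` (`tendsto_average_fst`).

Part 3 holds for any nondegenerate `σ : B → M(A)`, apart from the description of the range, which
uses that `σ` is an inclusion. The extension at `n` is the strict limit of the `σ(n e)`. Strict
continuity has to cover unbounded nets; it comes from an estimate `‖σ̄(n) a‖ ≤ C ‖n w‖` with `w` and
`C` depending only on `a` (`IsNondegenerate.exists_norm_extension_fst_le`), in the spirit of Cohen
factorisation. -/

lemma eq_of_forall_mul_right_eq {x y : A} (h : ∀ z, x * z = y * z) : x = y := by
  have := h (star (x - y))
  rw [← sub_eq_zero, ← sub_mul, CStarRing.mul_star_self_eq_zero_iff] at this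
  exact sub_eq_zero.1 this

/-- A double centralizer only carries the identity `snd x * y = x * fst y`. The module property
follows because an element of `A` is determined by its products with all others. -/
lemma fst_mul (m : 𝓜(ℂ, A)) (a b : A) : m.fst (a * b) = m.fst a * b := by
  have h (c : A) : c * m.fst (a * b) = c * (m.fst a * b) := by
    rw [← m.central, ← mul_assoc, m.central, mul_assoc]
  rw [← star_inj]
  refine eq_of_forall_mul_right_eq fun z => ?_
  simpa [star_mul] using congrArg star (h (star z))

lemma snd_mul (m : 𝓜(ℂ, A)) (a b : A) : m.snd (a * b) = a * m.snd b :=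
  eq_of_forall_mul_right_eq fun c => by
    rw [m.central, mul_assoc, mul_assoc, m.central]

lemma fst_snd_comm (m n : 𝓜(ℂ, A)) (a : A) : m.fst (n.snd a) = n.snd (m.fst a) :=
  eq_of_forall_mul_right_eq fun c => by
    rw [← fst_mul, n.central, n.central, fst_mul]

lemma multiplier_ext {m n : 𝓜(ℂ, A)} (h : ∀ a, m.fst a = n.fst a) : m = n := by
  refine DoubleCentralizer.ext ℂ A _ _ (Prod.ext (ContinuousLinearMap.ext h)
    (ContinuousLinearMap.ext fun a => eq_of_forall_mul_right_eq fun c => ?_))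
  rw [m.central, n.central, h]

lemma multiplier_ext_snd {m n : 𝓜(ℂ, A)} (h : ∀ a, m.snd a = n.snd a) : m = n := by
  rw [← star_inj]
  exact multiplier_ext fun a => by simp [h]

@[simp] lemma mul_fst_apply (m n : 𝓜(ℂ, A)) (a : A) : (m * n).fst a = m.fst (n.fst a) := rfl

@[simp] lemma mul_snd_apply (m n : 𝓜(ℂ, A)) (a : A) : (m * n).snd a = n.snd (m.snd a) := rfl

@[simp] lemma coe_fst_apply (a b : A) : (a : 𝓜(ℂ, A)).fst b = a * b := rfl

@[simp] lemma coe_snd_apply (a b : A) : (a : 𝓜(ℂ, A)).snd b = b * a := rfl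

lemma mul_coe (m : 𝓜(ℂ, A)) (a : A) : m * (a : 𝓜(ℂ, A)) = (m.fst a : 𝓜(ℂ, A)) :=
  multiplier_ext fun b => by simp [fst_mul]

lemma coe_mul (m : 𝓜(ℂ, A)) (a : A) : (a : 𝓜(ℂ, A)) * m = (m.snd a : 𝓜(ℂ, A)) :=
  multiplier_ext_snd fun b => by simp [snd_mul]

lemma coe_injective : Function.Injective fun a : A => (a : 𝓜(ℂ, A)) := fun a b h =>
  eq_of_forall_mul_right_eq fun c => by
    simpa using congrArg (fun m : 𝓜(ℂ, A) => m.fst c) h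

@[simp] lemma norm_coe (a : A) : ‖(a : 𝓜(ℂ, A))‖ = ‖a‖ :=
  NonUnitalStarAlgHom.norm_map (DoubleCentralizer.coeHom (𝕜 := ℂ) (A := A)) coe_injective a

lemma norm_fst_le (m : 𝓜(ℂ, A)) (a : A) : ‖m.fst a‖ ≤ ‖m‖ * ‖a‖ := by
  simpa using m.fst.le_opNorm a

lemma norm_snd_le (m : 𝓜(ℂ, A)) (a : A) : ‖m.snd a‖ ≤ ‖m‖ * ‖a‖ := by
  simpa using m.snd.le_opNorm a

lemma continuous_fst_apply (a : A) : Continuous fun m : 𝓜(ℂ, A) => m.fst a :=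
  (LipschitzWith.of_dist_le_mul (K := ‖a‖₊) fun x y => by
    rw [dist_eq_norm, dist_eq_norm, mul_comm]
    exact norm_fst_le (x - y) a).continuous

lemma continuous_snd_apply (a : A) : Continuous fun m : 𝓜(ℂ, A) => m.snd a :=
  (LipschitzWith.of_dist_le_mul (K := ‖a‖₊) fun x y => by
    rw [dist_eq_norm, dist_eq_norm, mul_comm]
    exact norm_snd_le (x - y) a).continuous

variable {B : Type*} [NonUnitalCStarAlgebra B]

lemma continuous_starHom (σ : B →⋆ₙₐ[ℂ] 𝓜(ℂ, A)) : Continuous σ :=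
  AddMonoidHomClass.continuous_of_bound σ 1 fun x => by
    simpa using NonUnitalStarAlgHom.norm_apply_le σ x

lemma map_fst_eq_star_snd (σ : B →⋆ₙₐ[ℂ] 𝓜(ℂ, A)) (b : B) (a : A) :
    (σ b).fst a = star ((σ (star b)).snd (star a)) := by
  simp [map_star]

lemma map_snd_eq_star_fst (σ : B →⋆ₙₐ[ℂ] 𝓜(ℂ, A)) (b : B) (a : A) :
    (σ b).snd a = star ((σ (star b)).fst (star a)) := by
  simp [map_star]

end MultiplierBasics

/-! ### Strict limits -/

section StrictLimit

variable {A : Type*} [NonUnitalCStarAlgebra A] {ι : Type*} {l : Filter ι}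

/-- Boundedness spreads the Cauchy property from the dense span to all of `E`, completeness supplies
the limits, and the bound `C` survives in the limit, which makes `L` continuous. -/
lemma exists_clm_limit {E : Type*} [NormedAddCommGroup E] [NormedSpace ℂ E] [CompleteSpace E]
    [NeBot l] {T : ι → E →L[ℂ] E} {C : ℝ} (hT : ∀ᶠ i in l, ‖T i‖ ≤ C) {D : Set E}
    (hD : Dense (Submodule.span ℂ D : Set E))
    (hlim : ∀ b ∈ D, ∃ c, Tendsto (fun i => T i b) l (𝓝 c)) :
    ∃ L : E →L[ℂ] E, ∀ b, Tendsto (fun i => T i b) l (𝓝 (L b)) := by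
  have hC : 0 ≤ C := by
    obtain ⟨i, hi⟩ := hT.exists
    exact (norm_nonneg _).trans hi
  have hspan : ∀ b ∈ Submodule.span ℂ D, ∃ c, Tendsto (fun i => T i b) l (𝓝 c) := by
    intro b hb
    induction hb using Submodule.span_induction with
    | mem x hx => exact hlim x hx
    | zero => exact ⟨0, by simp⟩
    | add x y _ _ hx hy =>
      obtain ⟨c, hc⟩ := hx
      obtain ⟨d, hd⟩ := hy
      exact ⟨c + d, by simpa using hc.add hd⟩
    | smul r x _ hx =>
      obtain ⟨c, hc⟩ := hx
      exact ⟨r • c, by simpa using hc.const_smul r⟩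
  have hall : ∀ b, ∃ c, Tendsto (fun i => T i b) l (𝓝 c) := by
    intro b
    refine cauchy_map_iff_exists_tendsto.1 ?_
    rw [Metric.cauchy_iff]
    refine ⟨inferInstance, fun ε hε => ?_⟩
    obtain ⟨d, hd, hbd⟩ := hD.exists_dist_lt b (ε := ε / (4 * (C + 1))) (by positivity)
    obtain ⟨c, hc⟩ := hspan d hd
    refine ⟨(fun i => T i b) '' {i | ‖T i‖ ≤ C ∧ dist (T i d) c < ε / 4},
      image_mem_map (hT.and (hc (Metric.ball_mem_nhds c (by positivity)))), ?_⟩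
    have key : ∀ i, ‖T i‖ ≤ C → dist (T i d) c < ε / 4 → dist (T i b) c < ε / 2 := by
      intro i hi hdi
      have h1 : dist (T i b) (T i d) ≤ ε / 4 := by
        rw [dist_eq_norm, ← map_sub]
        calc ‖T i (b - d)‖ ≤ C * ‖b - d‖ := (T i).le_of_opNorm_le hi _
          _ ≤ (C + 1) * (ε / (4 * (C + 1))) := by
            rw [← dist_eq_norm]; gcongr; linarith
          _ = ε / 4 := by field_simp
      linarith [dist_triangle (T i b) (T i d) c]
    rintro _ ⟨i, ⟨hi, hi'⟩, rfl⟩ _ ⟨j, ⟨hj, hj'⟩, rfl⟩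
    have := key i hi hi'
    have := key j hj hj'
    linarith [dist_triangle_right (T i b) (T j b) c]
  choose L hL using hall
  refine ⟨LinearMap.mkContinuous
    { toFun := L
      map_add' := fun x y => tendsto_nhds_unique (hL (x + y)) (by simpa using (hL x).add (hL y))
      map_smul' := fun r x =>
        tendsto_nhds_unique (hL (r • x)) (by simpa using (hL x).const_smul r) } C
    fun b => ?_, hL⟩
  exact le_of_tendsto (hL b).norm (hT.mono fun i hi => (T i).le_of_opNorm_le hi b)

/-- `m i → M` in the strict topology along `l`. -/
def StrictTendsto (m : ι → 𝓜(ℂ, A)) (l : Filter ι) (M : 𝓜(ℂ, A)) : Prop :=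
  (∀ b, Tendsto (fun i => (m i).fst b) l (𝓝 (M.fst b))) ∧
    ∀ b, Tendsto (fun i => (m i).snd b) l (𝓝 (M.snd b))

lemma strictTendsto_iff {m : ι → 𝓜(ℂ, A)} {M : 𝓜(ℂ, A)} :
    StrictTendsto m l M ↔ Tendsto m l (@nhds _ (strictTopology A) M) := by
  rw [nhds_induced, tendsto_comap_iff, nhds_prod_eq, tendsto_prod_iff', StrictTendsto]
  simp [tendsto_pi_nhds]

lemma StrictTendsto.add {m n : ι → 𝓜(ℂ, A)} {M N : 𝓜(ℂ, A)}
    (hm : StrictTendsto m l M) (hn : StrictTendsto n l N) :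
    StrictTendsto (fun i => m i + n i) l (M + N) :=
  ⟨fun b => by simpa using (hm.1 b).add (hn.1 b), fun b => by simpa using (hm.2 b).add (hn.2 b)⟩

lemma StrictTendsto.const_smul {m : ι → 𝓜(ℂ, A)} {M : 𝓜(ℂ, A)}
    (hm : StrictTendsto m l M) (c : ℂ) : StrictTendsto (fun i => c • m i) l (c • M) :=
  ⟨fun b => by simpa using (hm.1 b).const_smul c, fun b => by simpa using (hm.2 b).const_smul c⟩

lemma StrictTendsto.star {m : ι → 𝓜(ℂ, A)} {M : 𝓜(ℂ, A)} (hm : StrictTendsto m l M) :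
    StrictTendsto (fun i => star (m i)) l (star M) :=
  ⟨fun b => by simpa using (hm.2 (Star.star b)).star,
    fun b => by simpa using (hm.1 (Star.star b)).star⟩

lemma StrictTendsto.const_mul {m : ι → 𝓜(ℂ, A)} {M : 𝓜(ℂ, A)} (hm : StrictTendsto m l M)
    (n : 𝓜(ℂ, A)) : StrictTendsto (fun i => n * m i) l (n * M) :=
  ⟨fun b => (n.fst.continuous.tendsto _).comp (hm.1 b),
    fun b => by simpa using hm.2 (n.snd b)⟩

/-- A bounded net in `M(A)` whose left and right actions converge on sets with dense span has a
strict limit. -/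
lemma exists_strictTendsto [NeBot l] {m : ι → 𝓜(ℂ, A)} {C : ℝ} (hm : ∀ᶠ i in l, ‖m i‖ ≤ C)
    {D D' : Set A} (hD : Dense (Submodule.span ℂ D : Set A))
    (hD' : Dense (Submodule.span ℂ D' : Set A))
    (h : ∀ b ∈ D, ∃ c, Tendsto (fun i => (m i).fst b) l (𝓝 c))
    (h' : ∀ b ∈ D', ∃ c, Tendsto (fun i => (m i).snd b) l (𝓝 c)) :
    ∃ M, StrictTendsto m l M := by
  obtain ⟨L, hL⟩ := exists_clm_limit (T := fun i => (m i).fst) (by simpa using hm) hD h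
  obtain ⟨R, hR⟩ := exists_clm_limit (T := fun i => (m i).snd) (by simpa using hm) hD' h'
  -- The centralizer identity passes to the limit, so the left and right limits belong to one
  -- multiplier.
  exact ⟨⟨(L, R), fun x y => tendsto_nhds_unique ((hR x).mul_const y)
    (by simpa [(m _).central] using (hL y).const_mul x)⟩, hL, hR⟩

/-- The functional `m ↦ ψ (c m d)` is the strict extension of its restriction to `A`. -/
lemma isStrictExtension_mul_mul (ψ : A →L[ℂ] ℂ) (c d : A) :
    IsStrictExtension (ψ.comp ((ContinuousLinearMap.mul ℂ A c).comp
      ((ContinuousLinearMap.mul ℂ A).flip d)))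
      { toFun := fun m => ψ (c * m.fst d)
        map_add' := fun m n => by simp [mul_add]
        map_smul' := fun r m => by simp [mul_smul_comm] } := by
  refine ⟨?_, fun a => by simp⟩
  let := strictTopology A
  rw [continuous_iff_continuousAt]
  intro m
  have h := (strictTendsto_iff (m := fun n : 𝓜(ℂ, A) => n) (M := m)).2 tendsto_id
  exact (ψ.continuous.tendsto _).comp ((h.1 d).const_mul c)

/-- Strictly continuous functionals of the form `m ↦ ψ (c m d)` separate multipliers. -/
lemma multiplier_eq_of_strictExtension {m n : 𝓜(ℂ, A)}
    (h : ∀ (ω : A →L[ℂ] ℂ) (Ω : 𝓜(ℂ, A) →ₗ[ℂ] ℂ), IsStrictExtension ω Ω → Ω m = Ω n) : m = n := by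
  refine multiplier_ext fun d => ?_
  rw [← star_inj]
  refine eq_of_forall_mul_right_eq fun z => star_injective ?_
  simp only [star_mul, star_star]
  refine (SeparatingDual.eq_iff_forall_dual_eq (R := ℂ)).2 fun ψ => ?_
  exact h _ _ (isStrictExtension_mul_mul ψ (star z) d)

end StrictLimit

/-! ### Nondegenerate homomorphisms -/

section Nondegenerate

variable {A B : Type*} [NonUnitalCStarAlgebra A] [NonUnitalCStarAlgebra B]

lemma dense_span_of_star {D D' : Set A} (hD : Dense (Submodule.span ℂ D : Set A))
    (h : ∀ x ∈ D, star x ∈ Submodule.span ℂ D') : Dense (Submodule.span ℂ D' : Set A) := by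
  have hD2 : Dense (star '' (Submodule.span ℂ D : Set A)) :=
    star_involutive.surjective.denseRange.dense_image continuous_star hD
  refine hD2.mono ?_
  rintro _ ⟨x, hx, rfl⟩
  simp only [SetLike.mem_coe] at hx ⊢
  induction hx using Submodule.span_induction with
  | mem x hx => exact h x hx
  | zero => simp
  | add x y _ _ hx hy => simpa using add_mem hx hy
  | smul r x _ hx => simpa using Submodule.smul_mem _ _ hx

lemma IsNondegenerate.dense_snd {σ : B →⋆ₙₐ[ℂ] 𝓜(ℂ, A)} (hσ : IsNondegenerate σ) :
    Dense (Submodule.span ℂ {x : A | ∃ (b : B) (a : A), x = (σ b).snd a} : Set A) := by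
  refine dense_span_of_star hσ ?_
  rintro _ ⟨b, a, rfl⟩
  exact Submodule.subset_span ⟨star b, star a, by rw [map_snd_eq_star_fst]; simp⟩

lemma IsNondegenerate.multiplier_ext {σ : B →⋆ₙₐ[ℂ] 𝓜(ℂ, A)} (hσ : IsNondegenerate σ)
    {m n : 𝓜(ℂ, A)} (h : ∀ b, m * σ b = n * σ b) : m = n := by
  refine FixedPoint.multiplier_ext fun a => ?_
  have : Set.EqOn m.fst n.fst (Submodule.span ℂ {x : A | ∃ (b : B) (a : A), x = (σ b).fst a}) := by
    refine LinearMap.eqOn_span (f := (m.fst : A →ₗ[ℂ] A)) (g := (n.fst : A →ₗ[ℂ] A)) ?_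
    rintro _ ⟨b, a, rfl⟩
    exact congrArg (fun m : 𝓜(ℂ, A) => m.fst a) (h b)
  exact congrFun (Continuous.ext_on hσ m.fst.continuous n.fst.continuous this) a

end Nondegenerate

/-! ### Extension of a nondegenerate inclusion to the multiplier algebra -/

section Extension

variable {A B : Type*} [NonUnitalCStarAlgebra A] [NonUnitalCStarAlgebra B]

attribute [local instance] CStarAlgebra.spectralOrder CStarAlgebra.spectralOrderedRing

variable {σ : B →⋆ₙₐ[ℂ] 𝓜(ℂ, A)}

lemma IsNondegenerate.tendsto_fst_approximateUnit (hσ : IsNondegenerate σ) (a : A) :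
    Tendsto (fun e : B => (σ e).fst a) (CStarAlgebra.approximateUnit B) (𝓝 a) := by
  have hu := CStarAlgebra.increasingApproximateUnit B
  have hb : ∀ᶠ e : B in CStarAlgebra.approximateUnit B, ‖(σ e).fst‖ ≤ 1 :=
    hu.eventually_norm.mono fun e he => by
      simpa using (NonUnitalStarAlgHom.norm_apply_le σ e).trans he
  have hgen (b : B) (a : A) : Tendsto (fun e : B => (σ e).fst ((σ b).fst a))
      (CStarAlgebra.approximateUnit B) (𝓝 ((σ b).fst a)) := by
    have h1 := hu.tendsto_mul_right b
    have h2 : Continuous fun x : B => (σ x).fst a :=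
      (continuous_fst_apply a).comp (continuous_starHom σ)
    simpa [Function.comp_def] using (h2.tendsto b).comp h1
  obtain ⟨L, hL⟩ := exists_clm_limit hb hσ (by
    rintro _ ⟨b, a, rfl⟩
    exact ⟨_, hgen b a⟩)
  have : ∀ a, L a = a := by
    refine congrFun (Continuous.ext_on hσ L.continuous continuous_id ?_)
    refine LinearMap.eqOn_span (f := (L : A →ₗ[ℂ] A)) (g := LinearMap.id) ?_
    rintro _ ⟨b, a, rfl⟩
    exact tendsto_nhds_unique (hL _) (hgen b a)
  simpa [this] using hL a

/-- `M` is the strict limit of `σ(n e)` along the approximate unit: `σ(n e) σ(x) = σ(n (e x))` and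
`σ(x) σ(n e) = σ((x n) e)` both converge. By nondegeneracy the first identity already determines
`M`, so algebraic laws for the extension can be tested against `σ(x)`. -/
lemma IsNondegenerate.exists_extension (hσ : IsNondegenerate σ) (n : 𝓜(ℂ, B)) :
    ∃ M : 𝓜(ℂ, A), ∀ x : B, M * σ x = σ (n.fst x) ∧ σ x * M = σ (n.snd x) := by
  have hu := CStarAlgebra.increasingApproximateUnit B
  have hσc : Continuous σ := continuous_starHom σ
  have h1 (x : B) : Tendsto (fun e => σ (n.fst e) * σ x) (CStarAlgebra.approximateUnit B)
      (𝓝 (σ (n.fst x))) := by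
    simp only [← map_mul, ← fst_mul]
    exact ((hσc.comp n.fst.continuous).tendsto _).comp (hu.tendsto_mul_right x)
  have h2 (x : B) : Tendsto (fun e => σ x * σ (n.fst e)) (CStarAlgebra.approximateUnit B)
      (𝓝 (σ (n.snd x))) := by
    simp only [← map_mul, ← n.central]
    exact (hσc.tendsto _).comp (hu.tendsto_mul_left _)
  obtain ⟨M, hM⟩ := exists_strictTendsto (m := fun e => σ (n.fst e))
    (l := CStarAlgebra.approximateUnit B) (C := ‖n‖)
    (hu.eventually_norm.mono fun e he => (NonUnitalStarAlgHom.norm_apply_le σ _).trans <|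
      (norm_fst_le n e).trans (mul_le_of_le_one_right (norm_nonneg _) he))
    hσ hσ.dense_snd
    (by rintro _ ⟨x, a, rfl⟩; exact ⟨_, ((continuous_fst_apply a).tendsto _).comp (h1 x)⟩)
    (by rintro _ ⟨x, a, rfl⟩; exact ⟨_, ((continuous_snd_apply a).tendsto _).comp (h2 x)⟩)
  refine ⟨M, fun x => ⟨FixedPoint.multiplier_ext fun a => ?_, multiplier_ext_snd fun a => ?_⟩⟩
  · exact tendsto_nhds_unique (hM.1 _) (((continuous_fst_apply a).tendsto _).comp (h1 x))
  · exact tendsto_nhds_unique (hM.2 _) (((continuous_snd_apply a).tendsto _).comp (h2 x))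

/-- The extension of a nondegenerate homomorphism `σ : B → M(A)` to `M(B)`. -/
def IsNondegenerate.extension (hσ : IsNondegenerate σ) : 𝓜(ℂ, B) →⋆ₐ[ℂ] 𝓜(ℂ, A) where
  toFun n := (hσ.exists_extension n).choose
  map_one' := hσ.multiplier_ext fun x => by
    rw [((hσ.exists_extension _).choose_spec x).1]; simp
  map_mul' m n := hσ.multiplier_ext fun x => by
    rw [((hσ.exists_extension _).choose_spec x).1, mul_assoc,
      ((hσ.exists_extension _).choose_spec x).1, ((hσ.exists_extension _).choose_spec _).1]
    simp
  map_zero' := hσ.multiplier_ext fun x => by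
    rw [((hσ.exists_extension _).choose_spec x).1]; simp
  map_add' m n := hσ.multiplier_ext fun x => by
    rw [((hσ.exists_extension _).choose_spec x).1, add_mul,
      ((hσ.exists_extension _).choose_spec x).1, ((hσ.exists_extension _).choose_spec _).1]
    simp
  commutes' r := hσ.multiplier_ext fun x => by
    rw [((hσ.exists_extension _).choose_spec x).1]
    simp [Algebra.algebraMap_eq_smul_one]
  map_star' n := hσ.multiplier_ext fun x => by
    rw [((hσ.exists_extension _).choose_spec x).1, ← star_inj, star_mul, star_star, ← map_star σ,
      ← map_star σ, ((hσ.exists_extension _).choose_spec _).2]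
    simp

lemma IsNondegenerate.extension_mul (hσ : IsNondegenerate σ) (n : 𝓜(ℂ, B)) (x : B) :
    hσ.extension n * σ x = σ (n.fst x) := ((hσ.exists_extension n).choose_spec x).1

lemma IsNondegenerate.mul_extension (hσ : IsNondegenerate σ) (n : 𝓜(ℂ, B)) (x : B) :
    σ x * hσ.extension n = σ (n.snd x) := ((hσ.exists_extension n).choose_spec x).2

lemma IsNondegenerate.extension_coe (hσ : IsNondegenerate σ) (x : B) :
    hσ.extension (x : 𝓜(ℂ, B)) = σ x :=
  hσ.multiplier_ext fun y => by rw [hσ.extension_mul]; simp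

lemma IsNondegenerate.extension_unique (hσ : IsNondegenerate σ)
    (Ψ : 𝓜(ℂ, B) →⋆ₐ[ℂ] 𝓜(ℂ, A)) (hΨ : ∀ x : B, Ψ (x : 𝓜(ℂ, B)) = σ x) :
    Ψ = hσ.extension := by
  refine StarAlgHom.ext fun n => hσ.multiplier_ext fun x => ?_
  rw [hσ.extension_mul, ← hΨ, ← hΨ, ← map_mul, mul_coe]

lemma IsNondegenerate.extension_injective (hσ : IsNondegenerate σ) (hinj : Function.Injective σ) :
    Function.Injective hσ.extension := fun m n h =>
  FixedPoint.multiplier_ext fun x => hinj (by rw [← hσ.extension_mul, h, hσ.extension_mul])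

/-- Every `a : A` is dominated by a single element `w` of `B` under the extension. -/
lemma IsNondegenerate.exists_norm_extension_fst_le (hσ : IsNondegenerate σ) (a : A) :
    ∃ (w : B) (C : ℝ), 0 ≤ C ∧ ∀ n : 𝓜(ℂ, B), ‖(hσ.extension n).fst a‖ ≤ C * ‖n.fst w‖ := by
  have hu := CStarAlgebra.increasingApproximateUnit B
  have hstep : ∀ (r : A) (k : ℕ), ∃ e : B, 0 ≤ e ∧ ‖e‖ ≤ 1 ∧
      ‖r - (σ e).fst r‖ ≤ (1 / 4) ^ k := by
    intro r k
    have h := (hσ.tendsto_fst_approximateUnit r).eventually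
      (Metric.ball_mem_nhds r (show (0 : ℝ) < (1 / 4) ^ k by positivity))
    have := hu.neBot
    obtain ⟨e, he, he', he''⟩ := (h.and (hu.eventually_nonneg.and hu.eventually_norm)).exists
    exact ⟨e, he', he'', by
      rw [← dist_eq_norm, dist_comm]; exact (Metric.mem_ball.1 he).le⟩
  choose e he0 he1 hr using hstep
  -- Peeling off `σ(u k) (r k)` at each stage writes `a` as the sum of these terms, with remainders
  -- of order `(1/4)^k`.
  let r : ℕ → A := fun k => Nat.rec a (fun k x => x - (σ (e x k)).fst x) k
  have hr_succ (k : ℕ) : r (k + 1) = r k - (σ (e (r k) k)).fst (r k) := rfl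
  let u : ℕ → B := fun k => e (r k) k
  have hnorm (k : ℕ) : ‖r (k + 1)‖ ≤ (1 / 4) ^ k := hr _ _
  have hr0 : Tendsto r atTop (𝓝 0) := by
    rw [← tendsto_add_atTop_iff_nat 1]
    exact squeeze_zero_norm hnorm (tendsto_pow_atTop_nhds_zero_of_lt_one (by norm_num)
      (by norm_num))
  have hsum (N : ℕ) : ∑ k ∈ Finset.range N, (σ (u k)).fst (r k) = a - r N := by
    induction N with
    | zero => simp [r]
    | succ N ih => rw [Finset.sum_range_succ, ih, hr_succ]; abel
  have hlim : Tendsto (fun N => ∑ k ∈ Finset.range N, (σ (u k)).fst (r k)) atTop (𝓝 a) := by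
    simp only [hsum]
    simpa using tendsto_const_nhds.sub hr0
  have hterm0 (k : ℕ) : 0 ≤ ((1 / 2 : ℝ) ^ k) • (u k * star (u k)) :=
    smul_nonneg (by positivity) (mul_star_self_nonneg _)
  have hs : Summable fun k : ℕ => ((1 / 2 : ℝ) ^ k) • (u k * star (u k)) := by
    refine Summable.of_norm_bounded (g := fun k : ℕ => (1 / 2 : ℝ) ^ k)
      (summable_geometric_of_lt_one (by norm_num) (by norm_num)) fun k => ?_
    rw [norm_smul, CStarRing.norm_self_mul_star]
    have : ‖u k‖ ≤ 1 := he1 _ _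
    have h2 : ‖u k‖ * ‖u k‖ ≤ 1 := mul_le_one₀ this (norm_nonneg _) this
    simpa using mul_le_of_le_one_right (by positivity : (0 : ℝ) ≤ (1 / 2) ^ k) h2
  -- A single `v` with `v v* = ∑ 2^(-k) u_k u_k*` dominates every `u_k`. Conjugating by `n` keeps
  -- the inequality, hence `‖n u_k‖² ≤ 2^k ‖n v‖²`.
  obtain ⟨v, hv⟩ := CStarAlgebra.nonneg_iff_eq_mul_star_self.1 (tsum_nonneg hterm0)
  have hbound (n : 𝓜(ℂ, B)) (k : ℕ) : ‖n.fst (u k)‖ ≤ 2 ^ k * ‖n.fst v‖ := by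
    have hle : ((1 / 2 : ℝ) ^ k) • (u k * star (u k)) ≤ v * star v := by
      rw [← hv]
      exact hs.le_tsum k fun j _ => hterm0 j
    obtain ⟨z, hz⟩ := CStarAlgebra.nonneg_iff_eq_mul_star_self.1 (sub_nonneg.2 hle)
    have hconj (x : B) : n.fst x * star (n.fst x) = n.fst ((star n).snd (x * star x)) := by
      rw [snd_mul, fst_mul]; simp
    have hreal (c : ℝ) (x : B) : n.fst ((star n).snd (c • x)) = c • n.fst ((star n).snd x) := by
      rw [← Complex.coe_smul c x, map_smul, map_smul, Complex.coe_smul]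
    have hle' : ((1 / 2 : ℝ) ^ k) • (n.fst (u k) * star (n.fst (u k))) ≤
        n.fst v * star (n.fst v) := by
      rw [← sub_nonneg, hconj, hconj, ← hreal, ← map_sub, ← map_sub, hz, ← hconj]
      exact mul_star_self_nonneg _
    have h3 := CStarAlgebra.norm_le_norm_of_nonneg_of_le
      (smul_nonneg (by positivity) (mul_star_self_nonneg _)) hle'
    rw [norm_smul, CStarRing.norm_self_mul_star, CStarRing.norm_self_mul_star, norm_pow] at h3
    rw [Real.norm_of_nonneg (by norm_num)] at h3
    have h4 : ‖n.fst (u k)‖ * ‖n.fst (u k)‖ ≤ 2 ^ k * (‖n.fst v‖ * ‖n.fst v‖) := by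
      rwa [one_div, inv_pow, inv_mul_le_iff₀ (by positivity)] at h3
    have h5 : (1 : ℝ) ≤ 2 ^ k := one_le_pow₀ (by norm_num)
    -- The factor `√(2^k)` is rounded up to `2^k`; the decay `(1/4)^k` of the remainders still makes
    -- the series converge.
    refine abs_le_of_sq_le_sq' (?_ : _ ^ 2 ≤ _ ^ 2) (by positivity) |>.2
    nlinarith [mul_nonneg (norm_nonneg (n.fst v)) (norm_nonneg (n.fst v)),
      mul_nonneg (mul_nonneg (norm_nonneg (n.fst v)) (norm_nonneg (n.fst v)))
        (mul_nonneg (by positivity : (0 : ℝ) ≤ 2 ^ k) (sub_nonneg.2 h5))]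
  -- The factor `4` absorbs the index shift in `hnorm`, and the term `4 * ‖a‖` covers `r 0 = a`.
  have hrk (k : ℕ) : ‖r k‖ ≤ (4 + 4 * ‖a‖) * (1 / 4) ^ k := by
    cases k with
    | zero => simp [r]; linarith [norm_nonneg a]
    | succ k =>
      refine (hnorm k).trans ?_
      rw [pow_succ]
      nlinarith [norm_nonneg a, mul_nonneg (norm_nonneg a)
        (by positivity : (0 : ℝ) ≤ (1 / 4) ^ k)]
  refine ⟨v, (4 + 4 * ‖a‖) * 2, by positivity, fun n => ?_⟩
  refine le_of_tendsto (((hσ.extension n).fst.continuous.tendsto _).comp hlim).norm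
    (Eventually.of_forall fun N => ?_)
  have hext (k : ℕ) : (hσ.extension n).fst ((σ (u k)).fst (r k)) = (σ (n.fst (u k))).fst (r k) := by
    rw [← hσ.extension_mul]; rfl
  simp only [Function.comp_apply, map_sum, hext]
  calc ‖∑ k ∈ Finset.range N, (σ (n.fst (u k))).fst (r k)‖
      ≤ ∑ k ∈ Finset.range N, (4 + 4 * ‖a‖) * ‖n.fst v‖ * (1 / 2) ^ k := by
        refine norm_sum_le_of_le _ fun k _ => ?_
        calc ‖(σ (n.fst (u k))).fst (r k)‖ ≤ ‖n.fst (u k)‖ * ‖r k‖ :=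
            (norm_fst_le _ _).trans (mul_le_mul_of_nonneg_right
              (NonUnitalStarAlgHom.norm_apply_le σ _) (norm_nonneg _))
          _ ≤ (2 ^ k * ‖n.fst v‖) * ((4 + 4 * ‖a‖) * (1 / 4) ^ k) :=
            mul_le_mul (hbound n k) (hrk k) (norm_nonneg _) (by positivity)
          _ = (4 + 4 * ‖a‖) * ‖n.fst v‖ * (2 * (1 / 4)) ^ k := by rw [mul_pow]; ring
          _ = _ := by norm_num
    _ = (4 + 4 * ‖a‖) * ‖n.fst v‖ * ∑ k ∈ Finset.range N, (1 / 2 : ℝ) ^ k := by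
        rw [Finset.mul_sum]
    _ ≤ (4 + 4 * ‖a‖) * ‖n.fst v‖ * 2 := by
        gcongr
        exact sum_geometric_two_le N
    _ = _ := by ring

/-- Applying the domination by a single `w` to `n - m` handles the left actions without any bound on
the net; the right actions follow by taking adjoints. -/
lemma IsNondegenerate.continuous_extension (hσ : IsNondegenerate σ) :
    @Continuous _ _ (strictTopology B) (strictTopology A) hσ.extension := by
  have key (m : 𝓜(ℂ, B)) {l : Filter 𝓜(ℂ, B)} (h : StrictTendsto (fun n => n) l m) (a : A) :
      Tendsto (fun n => (hσ.extension n).fst a) l (𝓝 ((hσ.extension m).fst a)) := by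
    obtain ⟨w, C, -, hw⟩ := hσ.exists_norm_extension_fst_le a
    rw [tendsto_iff_norm_sub_tendsto_zero]
    refine squeeze_zero (fun _ => norm_nonneg _) (fun n => ?_)
      (by simpa using (tendsto_iff_norm_sub_tendsto_zero.1 (h.1 w)).const_mul C)
    simpa [map_sub] using hw (n - m)
  let := strictTopology B
  let := strictTopology A
  refine (@continuous_iff_continuousAt _ _ (strictTopology B) (strictTopology A) _).2 fun m => ?_
  have h : StrictTendsto (fun n : 𝓜(ℂ, B) => n) (@nhds _ (strictTopology B) m) m :=
    strictTendsto_iff.2 tendsto_id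
  refine strictTendsto_iff.1 ⟨key m h, fun a => ?_⟩
  have h' : StrictTendsto (fun n : 𝓜(ℂ, B) => n)
      (map star (@nhds _ (strictTopology B) m)) (star m) :=
    strictTendsto_iff.2 (strictTendsto_iff.1 h.star)
  have := (tendsto_map'_iff.1 (key (star m) h' (star a))).star
  simpa [Function.comp_def, map_star] using this

end Extension

/-! ### Compactly supported functions -/

section CompactSupport

variable {T : Type*} [TopologicalSpace T]

/-- A compactly supported continuous function as an element of `C₀(T)`. -/
def ofHasCompactSupport (f : T → ℂ) (hf : Continuous f) (hc : HasCompactSupport f) : C₀(T, ℂ) :=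
  ⟨⟨f, hf⟩, hc.is_zero_at_infty⟩

@[simp] lemma ofHasCompactSupport_apply (f : T → ℂ) (hf : Continuous f)
    (hc : HasCompactSupport f) (t : T) : ofHasCompactSupport f hf hc t = f t := rfl

lemma norm_le_of_forall {f : C₀(T, ℂ)} {C : ℝ} (hC : 0 ≤ C) (h : ∀ t, ‖f t‖ ≤ C) : ‖f‖ ≤ C := by
  rw [← ZeroAtInftyContinuousMap.norm_toBCF_eq_norm]
  exact (BoundedContinuousFunction.norm_le hC).2 h

lemma norm_apply_le_norm (f : C₀(T, ℂ)) (t : T) : ‖f t‖ ≤ ‖f‖ := by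
  rw [← ZeroAtInftyContinuousMap.norm_toBCF_eq_norm]
  exact f.toBCF.norm_coe_le_norm t

/-- Evaluation at a point of `T`. -/
def evalCLM (t : T) : C₀(T, ℂ) →L[ℂ] ℂ :=
  LinearMap.mkContinuous
    { toFun := fun f => f t
      map_add' := fun _ _ => rfl
      map_smul' := fun _ _ => rfl } 1 fun f => by simpa using norm_apply_le_norm f t

@[simp] lemma evalCLM_apply (t : T) (f : C₀(T, ℂ)) : evalCLM t f = f t := rfl

lemma hasCompactSupport_mul_left {f : C₀(T, ℂ)} (hf : HasCompactSupport f) (g : C₀(T, ℂ)) :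
    HasCompactSupport (f * g : C₀(T, ℂ)) := by
  rw [ZeroAtInftyContinuousMap.coe_mul]
  exact hf.mul_right

lemma hasCompactSupport_star {f : C₀(T, ℂ)} (hf : HasCompactSupport f) :
    HasCompactSupport (star f : C₀(T, ℂ)) := by
  refine hf.mono fun t ht => ?_
  rw [Function.mem_support] at ht ⊢
  contrapose! ht
  simp [ht]

variable [LocallyCompactSpace T] [T2Space T]

lemma exists_cutoff {K : Set T} (hK : IsCompact K) : ∃ χ : C₀(T, ℂ), HasCompactSupport χ ∧
    (∀ t ∈ K, χ t = 1) ∧ ∀ t, ‖1 - χ t‖ ≤ 1 := by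
  obtain ⟨f, hf1, -, hfc, hf⟩ := exists_continuous_one_zero_of_isCompact hK
    isClosed_empty (Set.disjoint_empty K)
  refine ⟨ofHasCompactSupport (fun t => (f t : ℂ)) (by fun_prop) ?_, ?_, ?_, ?_⟩
  · exact hfc.comp_left (g := ((↑) : ℝ → ℂ)) Complex.ofReal_zero
  · exact hfc.comp_left (g := ((↑) : ℝ → ℂ)) Complex.ofReal_zero
  · intro t ht
    simp [hf1 ht]
  · intro t
    rw [ofHasCompactSupport_apply, ← Complex.ofReal_one, ← Complex.ofReal_sub, Complex.norm_real,
      Real.norm_eq_abs, abs_le]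
    constructor <;> linarith [(hf t).1, (hf t).2]

lemma exists_hasCompactSupport_norm_sub_le (f : C₀(T, ℂ)) {ε : ℝ} (hε : 0 < ε) :
    ∃ g : C₀(T, ℂ), HasCompactSupport g ∧ ‖f - g‖ ≤ ε := by
  have h := (zero_at_infty f).eventually (Metric.ball_mem_nhds 0 hε)
  obtain ⟨K, hK, hKf⟩ := mem_cocompact.1 h
  obtain ⟨χ, hχc, hχ1, hχ⟩ := exists_cutoff hK
  refine ⟨χ * f, hasCompactSupport_mul_left hχc f, norm_le_of_forall hε.le fun t => ?_⟩
  have : (f - χ * f) t = (1 - χ t) * f t := by simp [sub_mul]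
  rw [this, norm_mul]
  by_cases ht : t ∈ K
  · simp [hχ1 t ht, hε.le]
  · have : ‖f t‖ < ε := by simpa using hKf ht
    exact (mul_le_of_le_one_left (norm_nonneg _) (hχ t)).trans this.le

variable {A : Type*} [NonUnitalCStarAlgebra A] {φ : C₀(T, ℂ) →⋆ₙₐ[ℂ] 𝓜(ℂ, A)}

lemma IsNondegenerate.dense_hasCompactSupport (hφ : IsNondegenerate φ) :
    Dense (Submodule.span ℂ {x : A | ∃ (g : C₀(T, ℂ)) (a : A), HasCompactSupport g ∧
      x = (φ g).fst a} : Set A) := by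
  have hd : Dense (Submodule.span ℂ {x : A | ∃ (f : C₀(T, ℂ)) (a : A), x = (φ f).fst a} : Set A) :=
    hφ
  rw [Submodule.dense_iff_topologicalClosure_eq_top, eq_top_iff] at hd ⊢
  refine hd.trans (Submodule.topologicalClosure_minimal _ (Submodule.span_le.2 ?_)
    (Submodule.isClosed_topologicalClosure _))
  rintro _ ⟨f, a, rfl⟩
  refine Metric.mem_closure_iff.2 fun ε hε => ?_
  obtain ⟨g, hg, hfg⟩ := exists_hasCompactSupport_norm_sub_le f
    (show 0 < ε / (2 * (‖a‖ + 1)) by positivity)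
  refine ⟨(φ g).fst a, Submodule.subset_span ⟨g, a, hg, rfl⟩, ?_⟩
  rw [dist_eq_norm, show (φ f).fst a - (φ g).fst a = (φ (f - g)).fst a by simp [map_sub]]
  calc _ ≤ ‖f - g‖ * ‖a‖ := (norm_fst_le _ _).trans
        (mul_le_mul_of_nonneg_right (NonUnitalStarAlgHom.norm_apply_le φ _) (norm_nonneg _))
    _ ≤ ε / (2 * (‖a‖ + 1)) * (‖a‖ + 1) := by gcongr; linarith
    _ = ε / 2 := by field_simp
    _ < ε := by linarith

lemma IsNondegenerate.dense_snd_hasCompactSupport (hφ : IsNondegenerate φ) :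
    Dense (Submodule.span ℂ {x : A | ∃ (g : C₀(T, ℂ)) (a : A), HasCompactSupport g ∧
      x = (φ g).snd a} : Set A) := by
  refine dense_span_of_star hφ.dense_hasCompactSupport ?_
  rintro _ ⟨b, a, hb, rfl⟩
  exact Submodule.subset_span ⟨star b, star a, hasCompactSupport_star hb, by
    rw [map_snd_eq_star_fst]; simp⟩

lemma IsNondegenerate.dense_coreSubspace (hφ : IsNondegenerate φ) :
    Dense (coreSubspace φ : Set A) := by
  have h1 := hφ.dense_hasCompactSupport
  have h2 := hφ.dense_snd_hasCompactSupport
  rw [Submodule.dense_iff_topologicalClosure_eq_top, eq_top_iff] at h1 ⊢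
  refine h1.trans (Submodule.topologicalClosure_minimal _ (Submodule.span_le.2 ?_)
    (Submodule.isClosed_topologicalClosure _))
  rintro _ ⟨f, a, hf, rfl⟩
  have hmem : ∀ b ∈ (Submodule.span ℂ {x : A | ∃ (g : C₀(T, ℂ)) (a : A), HasCompactSupport g ∧
      x = (φ g).snd a}), (φ f).fst b ∈ coreSubspace φ := by
    intro b hb
    induction hb using Submodule.span_induction with
    | mem x hx =>
      obtain ⟨g, a, hg, rfl⟩ := hx
      exact Submodule.subset_span ⟨f, g, a, hf, hg, rfl⟩
    | zero => simp
    | add x y _ _ hx hy => simpa using add_mem hx hy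
    | smul r x _ hx => simpa using Submodule.smul_mem _ _ hx
  exact map_mem_closure (φ f).fst.continuous (h2 a) hmem

end CompactSupport

/-! ### Proper actions -/

section ProperAction

variable {G T : Type*} [Group G] [TopologicalSpace G] [TopologicalSpace T] [MulAction Gᵐᵒᵖ T]

/-- The form in which properness of the action is used throughout. -/
lemma isCompact_transporter [ProperSMul Gᵐᵒᵖ T] {K L : Set T} (hK : IsCompact K)
    (hL : IsCompact L) : IsCompact {s : G | ∃ t ∈ K, op s • t ∈ L} := by
  convert (ProperSMul.isCompact_setOfPred_inter_nonempty (G := Gᵐᵒᵖ) hK hL).image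
    continuous_unop using 1
  ext s
  simp only [Set.mem_ofPred_eq, Set.mem_image, MulOpposite.exists, unop_op, exists_eq_right]
  constructor
  · rintro ⟨t, ht, h⟩
    exact ⟨_, Set.smul_mem_smul_set ht, h⟩
  · rintro ⟨_, ⟨t, ht, rfl⟩, h⟩
    exact ⟨t, ht, h⟩

lemma rt_star [ContinuousConstSMul Gᵐᵒᵖ T] (s : G) (f : C₀(T, ℂ)) :
    rt s (star f) = star (rt s f) := rfl

variable [IsTopologicalGroup G] [LocallyCompactSpace G] [ProperSMul Gᵐᵒᵖ T] [T2Space T]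

/-- For `s` in a compact neighbourhood `N` of `1`, both terms vanish off the compact set `supp f ·
N⁻¹`; on that set, continuity is uniform by compactness. -/
lemma eventually_norm_translate_sub_lt {f : C₀(T, ℂ)} (hf : HasCompactSupport f) {ε : ℝ}
    (hε : 0 < ε) : ∀ᶠ s : G in 𝓝 1, ∀ t, ‖f (op s • t) - f t‖ < ε := by
  obtain ⟨N, hN, hN1⟩ := exists_compact_mem_nhds (1 : G)
  have hact : Continuous fun p : G × T => op p.1 • p.2 := by fun_prop
  have hact' : Continuous fun p : G × T => op p.1⁻¹ • p.2 := by fun_prop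
  have hK := (hN.prod hf).image hact'
  have h := hK.eventually_forall_of_forall_eventually (x₀ := (1 : G))
    (P := fun s t => ‖f (op s • t) - f t‖ < ε) (by
      intro t _
      have hcont : Continuous fun p : G × T => ‖f (op p.1 • p.2) - f p.2‖ :=
        (((map_continuous f).comp hact).sub ((map_continuous f).comp continuous_snd)).norm
      exact hcont.continuousAt.eventually_lt continuousAt_const (by simpa using hε))
  filter_upwards [h, hN1] with s hs hsN t
  by_cases ht : t ∈ (fun p : G × T => op p.1⁻¹ • p.2) '' (N ×ˢ tsupport f)
  · exact hs t ht
  · have hz (r : G) (hr : r ∈ N) : f (op r • t) = 0 := by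
      by_contra hne
      exact ht ⟨(r, op r • t), ⟨hr, subset_tsupport _ hne⟩, by simp [smul_smul]⟩
    have h1 := hz 1 (mem_of_mem_nhds hN1)
    rw [op_one, one_smul] at h1
    simpa [hz s hsN, h1] using hε

lemma continuous_rt {f : C₀(T, ℂ)} (hf : HasCompactSupport f) :
    Continuous fun s : G => rt s f := by
  refine continuous_iff_continuousAt.2 fun r => Metric.tendsto_nhds.2 fun ε hε => ?_
  have h := eventually_norm_translate_sub_lt (G := G) hf (half_pos hε)
  have hr : Tendsto (fun s : G => r⁻¹ * s) (𝓝 r) (𝓝 1) := by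
    simpa using (continuous_const_mul r⁻¹).tendsto r
  filter_upwards [hr.eventually h] with s hs
  rw [dist_eq_norm]
  refine (norm_le_of_forall (half_pos hε).le fun t => ?_).trans_lt (half_lt_self hε)
  have := (hs (op r • t)).le
  rwa [smul_smul, ← op_mul, mul_inv_cancel_left] at this

variable [T2Space G] [MeasurableSpace G] [BorelSpace G] (μ : Measure G) [μ.IsHaarMeasure]

/-- If `t r ∈ K`, then `t s ∈ K` reads `(t r)(r⁻¹ s) ∈ K`, so the set on the left lies in a left
translate by `r` of the one on the right. The resulting bound does not depend on `t`. -/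
lemma measure_transporter_le {K : Set T} (t : T) :
    μ {s : G | op s • t ∈ K} ≤ μ {s : G | ∃ t ∈ K, op s • t ∈ K} := by
  rcases Set.eq_empty_or_nonempty {s : G | op s • t ∈ K} with h | ⟨r, hr⟩
  · simp [h]
  · rw [← measure_preimage_mul μ r⁻¹ {s : G | ∃ t ∈ K, op s • t ∈ K}]
    refine measure_mono fun s hs => ⟨op r • t, hr, ?_⟩
    rwa [smul_smul, ← op_mul, mul_inv_cancel_left]

lemma measureReal_transporter_le {K : Set T} (hK : IsCompact K) (t : T) :
    μ.real {s : G | op s • t ∈ K} ≤ μ.real {s : G | ∃ t ∈ K, op s • t ∈ K} :=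
  ENNReal.toReal_mono (isCompact_transporter hK hK).measure_ne_top (measure_transporter_le μ t)

lemma integrableOn_rt {f : C₀(T, ℂ)} (hf : HasCompactSupport f) {S K : Set G} (hK : IsCompact K)
    (hSK : S ⊆ K) : IntegrableOn (fun s => rt s f) S μ :=
  ((continuous_rt hf).continuousOn.integrableOn_compact hK).mono_set hSK

lemma setIntegral_rt_apply {f : C₀(T, ℂ)} (hf : HasCompactSupport f) {S K : Set G}
    (hK : IsCompact K) (hSK : S ⊆ K) (t : T) :
    (∫ s in S, rt s f ∂μ) t = ∫ s in S, f (op s • t) ∂μ :=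
  ((evalCLM t).integral_comp_comm (integrableOn_rt μ hf hK hSK)).symm

/-- At each `t` the integrand lives on the set of `s` with `t s` in the support of `f`, whose
measure is bounded uniformly in `t`. The bound is independent of `S`, and this is the source of
every uniform bound below. -/
lemma norm_setIntegral_rt_le {f : C₀(T, ℂ)} (hf : HasCompactSupport f) {S K : Set G}
    (hS : MeasurableSet S) (hK : IsCompact K) (hSK : S ⊆ K) :
    ‖∫ s in S, rt s f ∂μ‖ ≤
      ‖f‖ * μ.real {s : G | ∃ t ∈ tsupport f, op s • t ∈ tsupport f} := by
  refine norm_le_of_forall (by positivity) fun t => ?_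
  rw [setIntegral_rt_apply μ hf hK hSK]
  set E : Set G := {s : G | op s • t ∈ tsupport f} with hE
  have hEm : MeasurableSet E :=
    ((isClosed_tsupport f).preimage (f := fun s : G => op s • t) (by fun_prop)).measurableSet
  have hEfin : μ E < ⊤ := (measure_transporter_le μ t).trans_lt
    (isCompact_transporter hf hf).measure_lt_top
  rw [setIntegral_eq_of_subset_of_forall_sdiff_eq_zero hS (s := S ∩ E) Set.inter_subset_left
    (fun s hs => by
      by_contra hne
      exact hs.2 ⟨hs.1, subset_tsupport _ hne⟩)]
  refine (norm_setIntegral_le_of_norm_le_const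
    ((measure_mono Set.inter_subset_right).trans_lt hEfin)
    fun s _ => norm_apply_le_norm f _).trans ?_
  exact mul_le_mul_of_nonneg_left ((measureReal_mono Set.inter_subset_right hEfin.ne).trans
    (measureReal_transporter_le μ hf t)) (norm_nonneg _)

variable [LocallyCompactSpace T]

/-- A function whose square integrates to `1` along every orbit through a given compact set. -/
lemma exists_integral_orbit_eq_one {K : Set T} (hK : IsCompact K) :
    ∃ f : C₀(T, ℂ), HasCompactSupport f ∧
      ∀ t ∈ K, ∫ s : G, f (op s • t) * f (op s • t) ∂μ = 1 := by
  obtain ⟨h, hh1, -, hhc, hh⟩ := exists_continuous_one_zero_of_isCompact hK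
    isClosed_empty (Set.disjoint_empty K)
  set F : T → ℝ := fun t => ∫ s : G, h (op s • t) ∂μ with hF
  have hact : Continuous fun p : T × G => op p.2 • p.1 := by fun_prop
  have hFc : Continuous F := by
    refine continuous_iff_continuousAt.2 fun t => ?_
    obtain ⟨N, hN, hNt⟩ := exists_compact_mem_nhds t
    refine (continuousOn_integral_of_compact_support (s := N)
      (f := fun (t : T) (s : G) => h (op s • t)) (k := {s : G | ∃ t ∈ N, op s • t ∈ tsupport h})
      (isCompact_transporter hN hhc) ((map_continuous h).comp hact).continuousOn ?_).continuousAt hNt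
    intro u s hu hs
    by_contra hne
    exact hs ⟨u, hu, subset_tsupport _ hne⟩
  have hFinv (r : G) (t : T) : F (op r • t) = F t := by
    simp only [hF, smul_smul, ← op_mul]
    exact integral_mul_left_eq_self (fun s => h (op s • t)) r
  have hFpos : ∀ t ∈ K, 0 < F t := by
    intro t ht
    refine Continuous.integral_pos_of_hasCompactSupport_nonneg_nonzero (x := 1)
      (by fun_prop) ?_ (fun s => (hh _).1) (by simp [hh1 ht])
    refine HasCompactSupport.intro (isCompact_transporter (isCompact_singleton (x := t)) hhc)
      fun s hs => ?_
    by_contra hne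
    exact hs ⟨t, rfl, subset_tsupport _ hne⟩
  obtain ⟨δ, hδ, hδF⟩ : ∃ δ : ℝ, 0 < δ ∧ ∀ t ∈ K, δ ≤ F t := by
    rcases K.eq_empty_or_nonempty with rfl | hne
    · exact ⟨1, one_pos, by simp⟩
    · obtain ⟨t, ht, hmin⟩ := hK.exists_isMinOn hne hFc.continuousOn
      exact ⟨F t, hFpos t ht, fun u hu => hmin hu⟩
  -- Off the orbits through `K` the function `F` may vanish. The maximum with `δ` keeps the quotient
  -- continuous there and changes nothing on those orbits, as `F` is constant along each of them.
  have hmax (t : T) : 0 < max (F t) δ := lt_max_of_lt_right hδ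
  have hfc : Continuous fun t => ((√(h t / max (F t) δ) : ℝ) : ℂ) := by
    have : Continuous fun t => h t / max (F t) δ :=
      (map_continuous h).div₀ (hFc.max continuous_const) fun t => (hmax t).ne'
    fun_prop
  refine ⟨ofHasCompactSupport (fun t => ((√(h t / max (F t) δ) : ℝ) : ℂ)) hfc ?_, ?_, ?_⟩
  · exact hhc.mono fun t ht => by
      rw [Function.mem_support] at ht ⊢
      contrapose! ht
      simp [ht]
  · exact hhc.mono fun t ht => by
      rw [Function.mem_support] at ht ⊢
      contrapose! ht
      simp [ht]
  · intro t ht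
    have : ∀ s : G, (((√(h (op s • t) / max (F (op s • t)) δ) : ℝ) : ℂ) *
        ((√(h (op s • t) / max (F (op s • t)) δ) : ℝ) : ℂ)) = ((h (op s • t) / F t : ℝ) : ℂ) := by
      intro s
      rw [← Complex.ofReal_mul, Real.mul_self_sqrt (div_nonneg (hh _).1 (hmax _).le), hFinv,
        max_eq_left (hδF t ht)]
    simp only [ofHasCompactSupport_apply, this]
    rw [integral_complex_ofReal, integral_div, div_self (hFpos t ht).ne', Complex.ofReal_one]

end ProperAction

/-! ### Integrals over compact sets -/

section CompactIntegrals

variable {G : Type*} [TopologicalSpace G] [T2Space G] [LocallyCompactSpace G]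
  [MeasurableSpace G] [BorelSpace G] (μ : Measure G) [μ.Regular]

lemma measurableSet_compacts (K : Compacts G) : MeasurableSet (K : Set G) :=
  K.isCompact.isClosed.measurableSet

/-- `G` need not be σ-compact, and a regular measure is inner regular only on open sets and sets of
finite measure. The set `{f ≠ 0}` is exhausted by open sets on which `f` lies between `1/(n+1)` and
`n+1`: the lower bound forces finite measure, and the upper bound controls what a compact subset
misses. -/
lemma lintegral_le_of_forall_isCompact {f : G → ENNReal} (hf : Continuous f)
    (hf' : ∀ s, f s ≠ ⊤) {C : ENNReal} (hC : C ≠ ⊤)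
    (h : ∀ K, IsCompact K → ∫⁻ s in K, f s ∂μ ≤ C) : ∫⁻ s, f s ∂μ ≤ C := by
  let V : ℕ → Set G := fun n => {s | (n + 1 : ENNReal)⁻¹ < f s ∧ f s < n + 1}
  have hVo (n : ℕ) : IsOpen (V n) :=
    (isOpen_lt continuous_const hf).inter (isOpen_lt hf continuous_const)
  have hVmono : Monotone V := by
    intro m n hmn s hs
    have : (m : ENNReal) + 1 ≤ n + 1 := by gcongr
    exact ⟨(ENNReal.inv_le_inv.2 this).trans_lt hs.1, hs.2.trans_le this⟩
  have hV (n : ℕ) : ∫⁻ s in V n, f s ∂μ ≤ C := by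
    have hfin : μ (V n) < ⊤ := by
      have : μ (V n) ≤ (n + 1) * C := by
        rw [(hVo n).measure_eq_iSup_isCompact]
        refine iSup₂_le fun K hKV => iSup_le fun hK => ?_
        have h1 : (n + 1 : ENNReal)⁻¹ * μ K ≤ C := by
          rw [← setLIntegral_const]
          exact (setLIntegral_mono hf.measurable fun s hs => (hKV hs).1.le).trans (h K hK)
        calc μ K = (n + 1) * ((n + 1 : ENNReal)⁻¹ * μ K) := by
              rw [← mul_assoc, ENNReal.mul_inv_cancel (by simp) (by finiteness), one_mul]
          _ ≤ (n + 1) * C := by gcongr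
      exact this.trans_lt (by finiteness)
    refine ENNReal.le_of_forall_pos_le_add fun ε hε _ => ?_
    have hε' : (ε : ENNReal) / (n + 1) ≠ 0 := by
      simp [ENNReal.div_eq_zero_iff, hε.ne', ENNReal.add_eq_top]
    obtain ⟨K, hKV, hK, hdiff⟩ := (hVo n).measurableSet.exists_isCompact_sdiff_lt hfin.ne hε'
    have hKm := hK.isClosed.measurableSet
    calc ∫⁻ s in V n, f s ∂μ = ∫⁻ s in K ∪ V n \ K, f s ∂μ := by
          rw [Set.union_sdiff_cancel hKV]
      _ ≤ ∫⁻ s in K, f s ∂μ + ∫⁻ s in V n \ K, f s ∂μ := lintegral_union_le _ _ _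
      _ ≤ C + (n + 1) * μ (V n \ K) := by
          rw [← setLIntegral_const]
          gcongr ?_ + ?_
          · exact h K hK
          · exact setLIntegral_mono measurable_const fun s hs => hs.1.2.le
      _ ≤ C + (n + 1) * (ε / (n + 1)) := by gcongr
      _ ≤ C + ε := by gcongr; exact ENNReal.mul_div_le
  have hUnion : ⋃ n, V n = {s | f s ≠ 0} := by
    ext s
    simp only [Set.mem_iUnion, Set.mem_ofPred_eq, V]
    refine ⟨fun ⟨n, hn, _⟩ h0 => by simp [h0] at hn, fun h0 => ?_⟩
    obtain ⟨n, hn⟩ := ENNReal.exists_inv_nat_lt h0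
    obtain ⟨m, hm⟩ := ENNReal.exists_nat_gt (hf' s)
    refine ⟨max n m, lt_of_le_of_lt (ENNReal.inv_le_inv.2 ?_) hn, hm.trans_le ?_⟩
    · exact (Nat.cast_le.2 (le_max_left n m)).trans le_self_add
    · exact (Nat.cast_le.2 (le_max_right n m)).trans le_self_add
  calc ∫⁻ s, f s ∂μ = ∫⁻ s in ⋃ n, V n, f s ∂μ := by
        rw [hUnion, setLIntegral_eq_of_support_subset]
        exact fun s hs => hs
    _ = ⨆ n, ∫⁻ s in V n, f s ∂μ :=
        setLIntegral_iUnion_of_directed _ (hVmono.directed_le)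
    _ ≤ C := iSup_le hV

/-- Some compact set carries all but `ε` of `∫ ‖f‖`; otherwise the preceding bound would give `∫ ‖f‖
≤ ∫ ‖f‖ - ε`. -/
lemma tendsto_setIntegral_compacts {f : G → ℂ} (hc : Continuous f) (hf : Integrable f μ) :
    Tendsto (fun K : Compacts G => ∫ s in K, f s ∂μ) atTop (𝓝 (∫ s, f s ∂μ)) := by
  refine Metric.tendsto_atTop.2 fun ε hε => ?_
  obtain ⟨K₀, hK₀⟩ : ∃ K : Compacts G, ∫ s, ‖f s‖ ∂μ - ε < ∫ s in K, ‖f s‖ ∂μ := by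
    by_contra! h
    have h0 : 0 ≤ ∫ s, ‖f s‖ ∂μ - ε :=
      (integral_nonneg fun _ => norm_nonneg _).trans (h ⊥)
    have hle : ∫⁻ s, ‖f s‖ₑ ∂μ ≤ ENNReal.ofReal (∫ s, ‖f s‖ ∂μ - ε) := by
      refine lintegral_le_of_forall_isCompact μ hc.enorm (fun _ => enorm_ne_top)
        ENNReal.ofReal_ne_top fun K hK => ?_
      rw [← ofReal_integral_norm_eq_lintegral_enorm hf.integrableOn]
      exact ENNReal.ofReal_le_ofReal (h ⟨K, hK⟩)
    rw [← ofReal_integral_norm_eq_lintegral_enorm hf, ENNReal.ofReal_le_ofReal_iff h0] at hle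
    linarith
  refine ⟨K₀, fun K hK => ?_⟩
  rw [dist_comm, dist_eq_norm, ← integral_add_compl (measurableSet_compacts K) hf,
    add_sub_cancel_left]
  have h1 := integral_add_compl (measurableSet_compacts K) hf.norm
  have h2 : ∫ s in K₀, ‖f s‖ ∂μ ≤ ∫ s in K, ‖f s‖ ∂μ :=
    setIntegral_mono_set hf.norm.integrableOn (Eventually.of_forall fun _ => norm_nonneg _)
      (LE.le.eventuallyLE hK)
  calc ‖∫ s in (K : Set G)ᶜ, f s ∂μ‖ ≤ ∫ s in (K : Set G)ᶜ, ‖f s‖ ∂μ :=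
        norm_integral_le_integral_norm _
    _ < ε := by linarith

/-- Splitting a compact set by the sign of `u` bounds `∫ |u|` by `C + C`. This is why bounds are
needed over all measurable subsets of compact sets, not only over compact sets. -/
lemma integrable_of_forall_norm_setIntegral_le {u : G → ℝ} (hu : Continuous u) {C : ℝ}
    (h : ∀ S K, MeasurableSet S → IsCompact K → S ⊆ K → ‖∫ s in S, u s ∂μ‖ ≤ C) :
    Integrable u μ := by
  refine ⟨hu.aestronglyMeasurable, ?_⟩
  have hle : ∫⁻ s, ‖u s‖ₑ ∂μ ≤ ENNReal.ofReal (C + C) := by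
    refine lintegral_le_of_forall_isCompact μ hu.enorm (fun _ => enorm_ne_top)
      ENNReal.ofReal_ne_top fun K hK => ?_
    have hint : IntegrableOn u K μ := hu.continuousOn.integrableOn_compact hK
    have hKm := hK.isClosed.measurableSet
    have hP : MeasurableSet {s | 0 ≤ u s} := (isClosed_le continuous_const hu).measurableSet
    rw [← ofReal_integral_norm_eq_lintegral_enorm hint]
    refine ENNReal.ofReal_le_ofReal ?_
    rw [← integral_inter_add_sdiff hP hint.norm]
    have h1 : ∫ s in K ∩ {s | 0 ≤ u s}, ‖u s‖ ∂μ = ∫ s in K ∩ {s | 0 ≤ u s}, u s ∂μ :=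
      setIntegral_congr_fun (hKm.inter hP) fun s hs => Real.norm_of_nonneg hs.2
    have h2 : ∫ s in K \ {s | 0 ≤ u s}, ‖u s‖ ∂μ = -∫ s in K \ {s | 0 ≤ u s}, u s ∂μ := by
      rw [← integral_neg]
      exact setIntegral_congr_fun (hKm.diff hP) fun s hs =>
        Real.norm_of_nonpos (not_le.1 hs.2).le
    rw [h1, h2]
    exact add_le_add ((le_abs_self _).trans (h _ K (hKm.inter hP) hK Set.inter_subset_left))
      ((neg_le_abs _).trans (h _ K (hKm.diff hP) hK Set.sdiff_subset))
  exact hle.trans_lt ENNReal.ofReal_lt_top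

end CompactIntegrals

/-! ### Averages -/

section Averages

variable {G T A : Type*} [Group G] [TopologicalSpace G] [IsTopologicalGroup G]
  [LocallyCompactSpace G] [T2Space G] [MeasurableSpace G] [BorelSpace G]
  (μ : Measure G) [μ.IsHaarMeasure] [μ.Regular]
  [TopologicalSpace T] [LocallyCompactSpace T] [T2Space T] [MulAction Gᵐᵒᵖ T] [ProperSMul Gᵐᵒᵖ T]
  [NonUnitalCStarAlgebra A] {α : G →* (A ≃⋆ₐ[ℂ] A)} (hα : ∀ a : A, Continuous fun s : G => α s a)
  {φ : C₀(T, ℂ) →⋆ₙₐ[ℂ] 𝓜(ℂ, A)} (hφ : IsNondegenerate φ)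
  (hαφ : ∀ (s : G) (f : C₀(T, ℂ)), extendAut (α s) (φ f) = φ (rt s f))

include hαφ in
lemma map_fst (s : G) (f : C₀(T, ℂ)) (a : A) :
    α s ((φ f).fst a) = (φ (rt s f)).fst (α s a) := by
  rw [← hαφ]
  change _ = α s ((φ f).fst ((α s).symm (α s a)))
  simp

include hαφ in
lemma map_snd (s : G) (f : C₀(T, ℂ)) (a : A) :
    α s ((φ f).snd a) = (φ (rt s f)).snd (α s a) := by
  rw [← hαφ]
  change _ = α s ((φ f).snd ((α s).symm (α s a)))
  simp

include hα in
lemma integrableOn_orbit (x : A) {S K : Set G} (hK : IsCompact K) (hSK : S ⊆ K) :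
    IntegrableOn (fun s => α s x) S μ :=
  ((hα x).continuousOn.integrableOn_compact hK).mono_set hSK

/-- The integrals of `s ↦ α_s(x)` over relatively compact sets are uniformly bounded. -/
def AverageBounded (α : G →* (A ≃⋆ₐ[ℂ] A)) (x : A) : Prop :=
  ∃ C : ℝ, ∀ S K : Set G, MeasurableSet S → IsCompact K → S ⊆ K → ‖∫ s in S, α s x ∂μ‖ ≤ C

include hα in
lemma AverageBounded.add {x y : A} (hx : AverageBounded μ α x) (hy : AverageBounded μ α y) :
    AverageBounded μ α (x + y) := by
  obtain ⟨C, hC⟩ := hx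
  obtain ⟨D, hD⟩ := hy
  refine ⟨C + D, fun S K hS hK hSK => ?_⟩
  simp only [map_add]
  rw [integral_add (integrableOn_orbit μ hα x hK hSK) (integrableOn_orbit μ hα y hK hSK)]
  exact norm_add_le_of_le (hC S K hS hK hSK) (hD S K hS hK hSK)

lemma AverageBounded.smul {x : A} (hx : AverageBounded μ α x) (c : ℂ) :
    AverageBounded μ α (c • x) := by
  obtain ⟨C, hC⟩ := hx
  refine ⟨‖c‖ * C, fun S K hS hK hSK => ?_⟩
  simp only [map_smul]
  rw [integral_smul, norm_smul]
  exact mul_le_mul_of_nonneg_left (hC S K hS hK hSK) (norm_nonneg _)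

lemma AverageBounded.zero : AverageBounded μ α (0 : A) := ⟨0, fun S K _ _ _ => by simp⟩

/-- The inclusion of `A` in `M(A)` as a bounded linear map. -/
def coeCLM (A : Type*) [NonUnitalCStarAlgebra A] : A →L[ℂ] 𝓜(ℂ, A) :=
  LinearMap.mkContinuous
    (DoubleCentralizer.coeHom (𝕜 := ℂ) (A := A) : A →ₗ[ℂ] 𝓜(ℂ, A)) 1 fun a => by simp

@[simp] lemma coeCLM_apply (a : A) : coeCLM A a = (a : 𝓜(ℂ, A)) := rfl

/-! ### Uniform bounds from the order on `M(A)` -/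

section Order

attribute [local instance] CStarAlgebra.spectralOrder CStarAlgebra.spectralOrderedRing

lemma coe_nonneg {a : A} (ha : 0 ≤ a) : 0 ≤ (a : 𝓜(ℂ, A)) := by
  obtain ⟨b, rfl⟩ := CStarAlgebra.nonneg_iff_eq_mul_star_self.1 ha
  have h : ((b * star b : A) : 𝓜(ℂ, A)) = (b : 𝓜(ℂ, A)) * star (b : 𝓜(ℂ, A)) := by
    have := map_mul (DoubleCentralizer.coeHom (𝕜 := ℂ) (A := A)) b (star b)
    rwa [map_star] at this
  rw [h]
  exact mul_star_self_nonneg _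

/-- A `*`-homomorphism into `M(A)` as a bounded linear map. -/
def starHomCLM {B : Type*} [NonUnitalCStarAlgebra B] (σ : B →⋆ₙₐ[ℂ] 𝓜(ℂ, A)) :
    B →L[ℂ] 𝓜(ℂ, A) := ⟨(σ : B →ₗ[ℂ] 𝓜(ℂ, A)), continuous_starHom σ⟩

/-- Conjugate `a ≤ ‖a‖ · 1` by `φ(f)`. The comparison is made in `M(A)` because `φ(f f*)` need not
lie in `A`. -/
lemma coe_compression_le (f : C₀(T, ℂ)) {a : A} (ha : 0 ≤ a) :
    0 ≤ (((φ f).fst ((φ (star f)).snd a) : A) : 𝓜(ℂ, A)) ∧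
    (((φ f).fst ((φ (star f)).snd a) : A) : 𝓜(ℂ, A)) ≤ ‖a‖ • φ (f * star f) := by
  have h : (((φ f).fst ((φ (star f)).snd a) : A) : 𝓜(ℂ, A)) =
      φ f * (a : 𝓜(ℂ, A)) * star (φ f) := by
    rw [mul_assoc, ← map_star, coe_mul, mul_coe]
  rw [h]
  refine ⟨star_right_conjugate_nonneg (coe_nonneg ha) _, ?_⟩
  have h2 := star_right_conjugate_le_conjugate
    (IsSelfAdjoint.le_algebraMap_norm_self (a := (a : 𝓜(ℂ, A))) (.of_nonneg (coe_nonneg ha))) (φ f)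
  refine h2.trans_eq ?_
  rw [norm_coe, map_mul, map_star, Algebra.algebraMap_eq_smul_one, mul_smul_comm, mul_one,
    smul_mul_assoc]

include hα hαφ in
-- Each `α_s` preserves positivity and norm, so the orbit is dominated pointwise by `‖a‖ φ(rt_s(f
-- f*))`. Integrating preserves the order, and the norm is monotone on positive elements.
lemma averageBounded_compression {f : C₀(T, ℂ)} (hf : HasCompactSupport f) {a : A}
    (ha : 0 ≤ a) : AverageBounded μ α ((φ f).fst ((φ (star f)).snd a)) := by
  have hff := hasCompactSupport_mul_left hf (star f)
  refine ⟨‖a‖ * (‖f * star f‖ * μ.real {s : G | ∃ t ∈ tsupport (f * star f : C₀(T, ℂ)),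
    op s • t ∈ tsupport (f * star f : C₀(T, ℂ))}), fun S K hS hK hSK => ?_⟩
  have hx (s : G) : α s ((φ f).fst ((φ (star f)).snd a)) =
      (φ (rt s f)).fst ((φ (star (rt s f))).snd (α s a)) := by
    rw [map_fst hαφ, map_snd hαφ, rt_star]
  have hpos (s : G) : 0 ≤ α s a := map_nonneg (α s) ha
  have hnorm (s : G) : ‖α s a‖ = ‖a‖ := NonUnitalStarAlgHom.norm_map (α s) (α s).injective a
  have hint := integrableOn_orbit μ hα ((φ f).fst ((φ (star f)).snd a)) hK hSK
  have hint' : IntegrableOn (fun s => ‖a‖ • φ (rt s (f * star f))) S μ :=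
    ((starHomCLM φ).integrable_comp (integrableOn_rt μ hff hK hSK)).smul ‖a‖
  have hcoe : ((∫ s in S, α s ((φ f).fst ((φ (star f)).snd a)) ∂μ : A) : 𝓜(ℂ, A)) =
      ∫ s in S, ((α s ((φ f).fst ((φ (star f)).snd a)) : A) : 𝓜(ℂ, A)) ∂μ :=
    ((coeCLM A).integral_comp_comm hint).symm
  have hrt : ∫ s in S, ‖a‖ • φ (rt s (f * star f)) ∂μ =
      ‖a‖ • φ (∫ s in S, rt s (f * star f) ∂μ) := by
    rw [integral_smul]
    exact congrArg _ ((starHomCLM φ).integral_comp_comm (integrableOn_rt μ hff hK hSK))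
  rw [← norm_coe, hcoe]
  refine (CStarAlgebra.norm_le_norm_of_nonneg_of_le (b := ∫ s in S, ‖a‖ • φ (rt s (f * star f)) ∂μ)
    (integral_nonneg fun s => ?_) (setIntegral_mono ((coeCLM A).integrable_comp hint) hint'
      fun s => ?_)).trans ?_
  · simp only [hx]
    exact (coe_compression_le _ (hpos s)).1
  · simp only [hx, coeCLM_apply]
    have h := (coe_compression_le (φ := φ) (rt s f) (hpos s)).2
    rw [hnorm] at h
    exact h
  · rw [hrt, norm_smul, norm_norm]
    exact mul_le_mul_of_nonneg_left ((NonUnitalStarAlgHom.norm_apply_le φ _).trans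
      (norm_setIntegral_rt_le μ hff hS hK hSK)) (norm_nonneg _)

include hα hαφ in
lemma averageBounded_generator {f g : C₀(T, ℂ)} (hf : HasCompactSupport f)
    (hg : HasCompactSupport g) (a : A) : AverageBounded μ α ((φ f).fst ((φ g).snd a)) := by
  have ha : a ∈ Submodule.span ℂ {a : A | 0 ≤ a} := by
    rw [CStarAlgebra.span_nonneg]; trivial
  induction ha using Submodule.span_induction with
  | zero => simpa using AverageBounded.zero μ
  | add x y _ _ hx hy => simpa using AverageBounded.add μ hα hx hy
  | smul c x _ hx => simpa using AverageBounded.smul μ hx c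
  | mem a ha =>
    have hcs (c : ℂ) : HasCompactSupport (f + c • star g : C₀(T, ℂ)) := by
      rw [ZeroAtInftyContinuousMap.coe_add, ZeroAtInftyContinuousMap.coe_smul]
      exact hf.add ((hasCompactSupport_star hg).smul_left (f := fun _ => c))
    have hP (c : ℂ) := averageBounded_compression μ hα hαφ (hcs c) ha
    -- Polarisation: `4 φ(f) a φ(g) = ∑ c φ(f + c g*) a φ(f + c g*)*` over the fourth roots of unity
    -- `c`.
    have key : (φ f).fst ((φ g).snd a) = (1 / 4 : ℂ) •
        ((φ (f + (1 : ℂ) • star g)).fst ((φ (star (f + (1 : ℂ) • star g))).snd a) +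
        Complex.I • (φ (f + Complex.I • star g)).fst
          ((φ (star (f + Complex.I • star g))).snd a) +
        (-1 : ℂ) • (φ (f + (-1 : ℂ) • star g)).fst ((φ (star (f + (-1 : ℂ) • star g))).snd a) +
        (-Complex.I) • (φ (f + (-Complex.I) • star g)).fst
          ((φ (star (f + (-Complex.I) • star g))).snd a)) := by
      simp only [star_add, star_smul, star_star, map_add, map_smul, DoubleCentralizer.add_fst,
        DoubleCentralizer.add_snd, DoubleCentralizer.smul_fst, DoubleCentralizer.smul_snd,
        add_apply, smul_apply, RCLike.star_def, map_neg,
        map_one, Complex.conj_I]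
      simp only [smul_add, smul_smul]
      ring_nf
      simp only [Complex.I_sq]
      module
    rw [key]
    exact AverageBounded.smul μ (AverageBounded.add μ hα (AverageBounded.add μ hα
      (AverageBounded.add μ hα (hP 1) (AverageBounded.smul μ (hP _) _))
      (AverageBounded.smul μ (hP _) _)) (AverageBounded.smul μ (hP _) _)) _

include hα hαφ in
lemma averageBounded_of_mem_coreSubspace {x : A} (hx : x ∈ coreSubspace φ) :
    AverageBounded μ α x := by
  induction hx using Submodule.span_induction with
  | zero => exact AverageBounded.zero μ
  | add x y _ _ hx hy => exact AverageBounded.add μ hα hx hy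
  | smul c x _ hx => exact AverageBounded.smul μ hx c
  | mem x hx =>
    obtain ⟨f, g, a, hf, hg, rfl⟩ := hx
    exact averageBounded_generator μ hα hαφ hf hg a

end Order

end Averages

/-! ### Existence, uniqueness and invariance of averages as strict limits -/

section StrictAverages

variable {G T A : Type*} [Group G] [TopologicalSpace G] [IsTopologicalGroup G]
  [LocallyCompactSpace G] [T2Space G] [MeasurableSpace G] [BorelSpace G]
  (μ : Measure G) [μ.IsHaarMeasure] [μ.Regular]
  [TopologicalSpace T] [LocallyCompactSpace T] [T2Space T] [MulAction Gᵐᵒᵖ T] [ProperSMul Gᵐᵒᵖ T]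
  [NonUnitalCStarAlgebra A] {α : G →* (A ≃⋆ₐ[ℂ] A)} (hα : ∀ a : A, Continuous fun s : G => α s a)
  {φ : C₀(T, ℂ) →⋆ₙₐ[ℂ] 𝓜(ℂ, A)} (hφ : IsNondegenerate φ)
  (hαφ : ∀ (s : G) (f : C₀(T, ℂ)), extendAut (α s) (φ f) = φ (rt s f))

/-- `m` is the strict limit of the integrals of `s ↦ α_s(x)` over compact sets. -/
def IsStrictAverage (α : G →* (A ≃⋆ₐ[ℂ] A)) (x : A) (m : 𝓜(ℂ, A)) : Prop :=
  StrictTendsto (fun K : Compacts G => ((∫ s in K, α s x ∂μ : A) : 𝓜(ℂ, A))) atTop m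

lemma mul_rt_eq_zero {f g : C₀(T, ℂ)} {s : G}
    (hs : s ∉ {s : G | ∃ t ∈ tsupport g, op s • t ∈ tsupport f}) : g * rt s f = 0 := by
  ext t
  by_contra hne
  rw [ZeroAtInftyContinuousMap.mul_apply, ZeroAtInftyContinuousMap.zero_apply, mul_eq_zero,
    not_or] at hne
  exact hs ⟨t, subset_tsupport _ hne.1, subset_tsupport _ hne.2⟩

include hαφ in
-- On a generator the product contains the factor `φ(g · rt_s f)`, which vanishes unless translation
-- by `s` moves a point of `supp g` into `supp f`.
lemma exists_compact_fst_eq_zero {g : C₀(T, ℂ)} (hg : HasCompactSupport g) {x : A}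
    (hx : x ∈ coreSubspace φ) : ∃ K : Compacts G, ∀ s ∉ K, (φ g).fst (α s x) = 0 := by
  induction hx using Submodule.span_induction with
  | zero => exact ⟨⊥, by simp⟩
  | add x y _ _ hx hy =>
    obtain ⟨K, hK⟩ := hx
    obtain ⟨L, hL⟩ := hy
    refine ⟨K ⊔ L, fun s hs => ?_⟩
    rw [map_add, map_add, hK s fun h => hs (Or.inl h), hL s fun h => hs (Or.inr h), add_zero]
  | smul c x _ hx =>
    obtain ⟨K, hK⟩ := hx
    exact ⟨K, fun s hs => by rw [map_smul, map_smul, hK s hs, smul_zero]⟩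
  | mem x hx =>
    obtain ⟨f, k, a, hf, hk, rfl⟩ := hx
    refine ⟨⟨_, isCompact_transporter hg hf⟩, fun s hs => ?_⟩
    rw [map_fst hαφ, ← mul_fst_apply, ← map_mul, mul_rt_eq_zero hs, map_zero]
    rfl

include hαφ in
lemma exists_compact_snd_eq_zero {g : C₀(T, ℂ)} (hg : HasCompactSupport g) {x : A}
    (hx : x ∈ coreSubspace φ) : ∃ K : Compacts G, ∀ s ∉ K, (φ g).snd (α s x) = 0 := by
  induction hx using Submodule.span_induction with
  | zero => exact ⟨⊥, by simp⟩
  | add x y _ _ hx hy =>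
    obtain ⟨K, hK⟩ := hx
    obtain ⟨L, hL⟩ := hy
    refine ⟨K ⊔ L, fun s hs => ?_⟩
    rw [map_add, map_add, hK s fun h => hs (Or.inl h), hL s fun h => hs (Or.inr h), add_zero]
  | smul c x _ hx =>
    obtain ⟨K, hK⟩ := hx
    exact ⟨K, fun s hs => by rw [map_smul, map_smul, hK s hs, smul_zero]⟩
  | mem x hx =>
    obtain ⟨f, k, a, hf, hk, rfl⟩ := hx
    refine ⟨⟨_, isCompact_transporter hg hk⟩, fun s hs => ?_⟩
    rw [fst_snd_comm, map_snd hαφ, ← mul_snd_apply, ← map_mul, mul_comm, mul_rt_eq_zero hs,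
      map_zero]
    rfl

include hα in
lemma clm_setIntegral_eq {E : Type*} [NormedAddCommGroup E] [NormedSpace ℂ E] [CompleteSpace E]
    {x : A} (L : A →L[ℂ] E) {K₀ K : Compacts G} (h : ∀ s ∉ K₀, L (α s x) = 0) (hK : K₀ ≤ K) :
    L (∫ s in K, α s x ∂μ) = ∫ s in K₀, L (α s x) ∂μ := by
  rw [← L.integral_comp_comm (integrableOn_orbit μ hα x K.isCompact subset_rfl)]
  exact setIntegral_eq_of_subset_of_forall_sdiff_eq_zero (measurableSet_compacts K) hK
    fun s hs => h s hs.2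

include hα hφ hαφ in
-- Applied to `φ(g) a` or `a φ(g)` with `g` compactly supported, the integrals over compact sets are
-- eventually constant; such elements span dense subspaces, and the uniform bound does the rest.
lemma exists_isStrictAverage {x : A} (hx : x ∈ coreSubspace φ) :
    ∃ m, IsStrictAverage μ α x m := by
  obtain ⟨C, hC⟩ := averageBounded_of_mem_coreSubspace μ hα hαφ hx
  refine exists_strictTendsto (C := C) (Eventually.of_forall fun K => ?_)
    hφ.dense_hasCompactSupport hφ.dense_snd_hasCompactSupport ?_ ?_
  · rw [norm_coe]
    exact hC K K (measurableSet_compacts K) K.isCompact subset_rfl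
  · rintro _ ⟨g, a, hg, rfl⟩
    obtain ⟨K₀, hK₀⟩ := exists_compact_snd_eq_zero hαφ hg hx
    refine ⟨(∫ s in K₀, (φ g).snd (α s x) ∂μ) * a, tendsto_const_nhds.congr' ?_⟩
    filter_upwards [eventually_ge_atTop K₀] with K hK
    rw [coe_fst_apply, ← (φ g).central, clm_setIntegral_eq μ hα _ hK₀ hK]
  · rintro _ ⟨g, a, hg, rfl⟩
    obtain ⟨K₀, hK₀⟩ := exists_compact_fst_eq_zero hαφ hg hx
    refine ⟨a * ∫ s in K₀, (φ g).fst (α s x) ∂μ, tendsto_const_nhds.congr' ?_⟩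
    filter_upwards [eventually_ge_atTop K₀] with K hK
    rw [coe_snd_apply, (φ g).central, clm_setIntegral_eq μ hα _ hK₀ hK]

include hα in
lemma AverageBounded.integrable {x : A} (hx : AverageBounded μ α x) (ω : A →L[ℂ] ℂ) :
    Integrable (fun s => ω (α s x)) μ := by
  obtain ⟨C, hC⟩ := hx
  have hcont : Continuous fun s => ω (α s x) := ω.continuous.comp (hα x)
  have hb (S K : Set G) (hS : MeasurableSet S) (hK : IsCompact K) (hSK : S ⊆ K) :
      ‖∫ s in S, ω (α s x) ∂μ‖ ≤ ‖ω‖ * C := by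
    rw [ω.integral_comp_comm (integrableOn_orbit μ hα x hK hSK)]
    exact ω.le_opNorm_of_le (hC S K hS hK hSK)
  have hint (S K : Set G) (hK : IsCompact K) (hSK : S ⊆ K) :
      IntegrableOn (fun s => ω (α s x)) S μ :=
    (hcont.continuousOn.integrableOn_compact hK).mono_set hSK
  refine Integrable.re_im_iff.1 ⟨?_, ?_⟩
  · refine integrable_of_forall_norm_setIntegral_le (C := ‖ω‖ * C) μ
      (Complex.continuous_re.comp hcont) fun S K hS hK hSK => ?_
    rw [show ∫ s in S, (RCLike.re (ω (α s x)) : ℝ) ∂μ = (∫ s in S, ω (α s x) ∂μ).re from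
      integral_re (hint S K hK hSK)]
    exact (Complex.abs_re_le_norm _).trans (hb S K hS hK hSK)
  · refine integrable_of_forall_norm_setIntegral_le (C := ‖ω‖ * C) μ
      (Complex.continuous_im.comp hcont) fun S K hS hK hSK => ?_
    rw [show ∫ s in S, (RCLike.im (ω (α s x)) : ℝ) ∂μ = (∫ s in S, ω (α s x) ∂μ).im from
      integral_im (hint S K hK hSK)]
    exact (Complex.abs_im_le_norm _).trans (hb S K hS hK hSK)

include hα in
lemma IsStrictAverage.isAverage {x : A} {m : 𝓜(ℂ, A)} (hx : AverageBounded μ α x)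
    (hm : IsStrictAverage μ α x m) : IsAverage μ α x m := by
  intro ω
  have hint := AverageBounded.integrable μ hα hx ω
  refine ⟨hint, fun Ω hΩ => ?_⟩
  have h1 := tendsto_setIntegral_compacts μ (ω.continuous.comp (hα x)) hint
  refine tendsto_nhds_unique ?_ h1
  have h2 := (@Continuous.tendsto _ _ (strictTopology A) _ _ hΩ.1 m).comp (strictTendsto_iff.1 hm)
  refine h2.congr fun K => ?_
  rw [Function.comp_apply, hΩ.2,
    ← ω.integral_comp_comm (integrableOn_orbit μ hα x K.isCompact subset_rfl)]
  rfl

lemma IsAverage.unique {x : A} {m n : 𝓜(ℂ, A)} (hm : IsAverage μ α x m)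
    (hn : IsAverage μ α x n) : m = n :=
  multiplier_eq_of_strictExtension fun ω Ω hΩ => by rw [(hm ω).2 Ω hΩ, (hn ω).2 Ω hΩ]

include hα hφ hαφ in
-- Lets the algebra of averages be carried out with strict limits in place of functionals.
lemma isAverage_iff_isStrictAverage {x : A} (hx : x ∈ coreSubspace φ) {m : 𝓜(ℂ, A)} :
    IsAverage μ α x m ↔ IsStrictAverage μ α x m := by
  have hb := averageBounded_of_mem_coreSubspace μ hα hαφ hx
  refine ⟨fun h => ?_, IsStrictAverage.isAverage μ hα hb⟩
  obtain ⟨n, hn⟩ := exists_isStrictAverage μ hα hφ hαφ hx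
  rwa [h.unique μ (hn.isAverage μ hα hb)]

include hα hφ hαφ in
lemma existsUnique_isAverage {x : A} (hx : x ∈ coreSubspace φ) : ∃! m, IsAverage μ α x m := by
  obtain ⟨m, hm⟩ := exists_isStrictAverage μ hα hφ hαφ hx
  exact ⟨m, (isAverage_iff_isStrictAverage μ hα hφ hαφ hx).2 hm, fun n hn =>
    hn.unique μ ((isAverage_iff_isStrictAverage μ hα hφ hαφ hx).2 hm)⟩

include hα in
lemma IsStrictAverage.add {x y : A} {m n : 𝓜(ℂ, A)} (hm : IsStrictAverage μ α x m)
    (hn : IsStrictAverage μ α y n) : IsStrictAverage μ α (x + y) (m + n) := by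
  have : (fun K : Compacts G => ((∫ s in K, α s (x + y) ∂μ : A) : 𝓜(ℂ, A))) = fun K : Compacts G =>
      ((∫ s in K, α s x ∂μ : A) : 𝓜(ℂ, A)) + ((∫ s in K, α s y ∂μ : A) : 𝓜(ℂ, A)) := by
    funext K
    simp only [map_add]
    rw [integral_add (integrableOn_orbit μ hα x K.isCompact subset_rfl)
      (integrableOn_orbit μ hα y K.isCompact subset_rfl)]
    exact map_add (coeCLM A) _ _
  rw [IsStrictAverage, this]
  exact StrictTendsto.add hm hn

lemma IsStrictAverage.smul {x : A} {m : 𝓜(ℂ, A)} (hm : IsStrictAverage μ α x m) (c : ℂ) :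
    IsStrictAverage μ α (c • x) (c • m) := by
  have : (fun K : Compacts G => ((∫ s in K, α s (c • x) ∂μ : A) : 𝓜(ℂ, A))) =
      fun K : Compacts G => c • ((∫ s in K, α s x ∂μ : A) : 𝓜(ℂ, A)) := by
    funext K
    simp only [map_smul]
    rw [integral_smul]
    exact map_smul (coeCLM A) _ _
  rw [IsStrictAverage, this]
  exact StrictTendsto.const_smul hm c

include hα in
lemma IsStrictAverage.star {x : A} {m : 𝓜(ℂ, A)} (hm : IsStrictAverage μ α x m) :
    IsStrictAverage μ α (star x) (star m) := by
  have : (fun K : Compacts G => ((∫ s in K, α s (Star.star x) ∂μ : A) : 𝓜(ℂ, A))) =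
      fun K : Compacts G => Star.star ((∫ s in K, α s x ∂μ : A) : 𝓜(ℂ, A)) := by
    funext K
    simp only [map_star]
    rw [show ∫ s in K, Star.star (α s x) ∂μ = Star.star (∫ s in K, α s x ∂μ) from
      (((starL' ℝ : A ≃L[ℝ] A) : A →L[ℝ] A).integral_comp_comm
        (integrableOn_orbit μ hα x K.isCompact subset_rfl))]
    exact map_star (DoubleCentralizer.coeHom (𝕜 := ℂ) (A := A)) _
  rw [IsStrictAverage, this]
  exact StrictTendsto.star hm

include hα in
/-- Averages are invariant under the action. -/
lemma IsStrictAverage.map_fst {x : A} {m : 𝓜(ℂ, A)} (hm : IsStrictAverage μ α x m) (r : G)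
    (b : A) : α r (m.fst b) = m.fst (α r b) := by
  have hc : Continuous (α r) := (autCLM (α r)).continuous
  have h1 := (hc.tendsto _).comp (hm.1 b)
  -- `α_r` turns the integral over `K` into the integral over `r K`, and `K ↦ r K` tends to infinity
  -- among compact sets, so the limit is unchanged.
  let Θ : Compacts G → Compacts G := Compacts.map (fun s => r * s) (continuous_const_mul r)
  have hΘ : Tendsto Θ atTop atTop := by
    refine tendsto_atTop.2 fun K => ?_
    filter_upwards [eventually_ge_atTop
      (Compacts.map (fun s => r⁻¹ * s) (continuous_const_mul r⁻¹) K)] with L hL s hs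
    exact ⟨r⁻¹ * s, hL ⟨s, hs, rfl⟩, by simp⟩
  refine tendsto_nhds_unique h1 (((hm.1 (α r b)).comp hΘ).congr fun K => ?_)
  simp only [Function.comp_apply, coe_fst_apply, map_mul]
  congr 1
  have h2 : ∫ s in (Θ K : Set G), α s x ∂μ = ∫ s in K, α (r * s) x ∂μ := by
    have := (measurePreserving_mul_left μ r).setIntegral_preimage_emb
      (measurableEmbedding_mulLeft r) (fun s => α s x) (Θ K : Set G)
    rw [← this]
    congr 2
    ext s
    simp [Θ]
  rw [h2]
  simp only [map_mul]
  exact (autCLM (α r)).integral_comp_comm (integrableOn_orbit μ hα x K.isCompact subset_rfl)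

end StrictAverages

/-! ### The fixed-point algebra -/

section FixedPointAlgebra

variable {G T A : Type*} [Group G] [TopologicalSpace G] [IsTopologicalGroup G]
  [LocallyCompactSpace G] [T2Space G] [MeasurableSpace G] [BorelSpace G]
  (μ : Measure G) [μ.IsHaarMeasure] [μ.Regular]
  [TopologicalSpace T] [LocallyCompactSpace T] [T2Space T] [MulAction Gᵐᵒᵖ T] [ProperSMul Gᵐᵒᵖ T]
  [NonUnitalCStarAlgebra A] {α : G →* (A ≃⋆ₐ[ℂ] A)} (hα : ∀ a : A, Continuous fun s : G => α s a)
  {φ : C₀(T, ℂ) →⋆ₙₐ[ℂ] 𝓜(ℂ, A)} (hφ : IsNondegenerate φ)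
  (hαφ : ∀ (s : G) (f : C₀(T, ℂ)), extendAut (α s) (φ f) = φ (rt s f))

include hα in
lemma IsStrictAverage.fst_eq_setIntegral {x : A} {m : 𝓜(ℂ, A)} (hm : IsStrictAverage μ α x m)
    {d : A} {K₀ : Compacts G} (h : ∀ s ∉ K₀, α s x * d = 0) :
    m.fst d = ∫ s in K₀, α s x * d ∂μ := by
  refine tendsto_nhds_unique (hm.1 d) (tendsto_const_nhds.congr' ?_)
  filter_upwards [eventually_ge_atTop K₀] with K hK
  exact (clm_setIntegral_eq μ hα ((ContinuousLinearMap.mul ℂ A).flip d) h hK).symm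

include hαφ in
-- For a generator `φ(f) a φ(k)` and all `s ∈ K`, the functions `rt_s f` are supported in the one
-- compact set `supp f · K⁻¹`.
lemma exists_compact_forall_fst_eq_self (K : Compacts G) {x : A} (hx : x ∈ coreSubspace φ) :
    ∃ L : Compacts T, ∀ χ : C₀(T, ℂ), (∀ t ∈ L, χ t = 1) →
      ∀ s ∈ K, (φ χ).fst (α s x) = α s x := by
  induction hx using Submodule.span_induction with
  | zero => exact ⟨⊥, by simp⟩
  | add x y _ _ hx hy =>
    obtain ⟨L, hL⟩ := hx
    obtain ⟨M, hM⟩ := hy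
    refine ⟨L ⊔ M, fun χ hχ s hs => ?_⟩
    rw [map_add, map_add, hL χ (fun t ht => hχ t (Or.inl ht)) s hs,
      hM χ (fun t ht => hχ t (Or.inr ht)) s hs]
  | smul c x _ hx =>
    obtain ⟨L, hL⟩ := hx
    exact ⟨L, fun χ hχ s hs => by rw [map_smul, map_smul, hL χ hχ s hs]⟩
  | mem x hx =>
    obtain ⟨f, k, a, hf, hk, rfl⟩ := hx
    have hact : Continuous fun p : G × T => op p.1⁻¹ • p.2 := by fun_prop
    refine ⟨⟨_, (K.isCompact.prod hf).image hact⟩, fun χ hχ s hs => ?_⟩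
    rw [map_fst hαφ, ← mul_fst_apply, ← map_mul]
    have : χ * rt s f = rt s f := by
      ext t
      rw [ZeroAtInftyContinuousMap.mul_apply]
      by_cases h0 : rt s f t = 0
      · simp [h0]
      · rw [hχ t ⟨(s, op s • t), ⟨hs, subset_tsupport _ h0⟩, by simp [smul_smul]⟩, one_mul]
    rw [this]

include hα hαφ in
/-- `E(A₀) A₀ ⊆ A₀`. -/
lemma IsStrictAverage.fst_mem_coreSubspace {x : A} (hx : x ∈ coreSubspace φ) {m : 𝓜(ℂ, A)}
    (hm : IsStrictAverage μ α x m) {b : A} (hb : b ∈ coreSubspace φ) :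
    m.fst b ∈ coreSubspace φ := by
  induction hb using Submodule.span_induction with
  | zero => simp
  | add x y _ _ hx hy => simpa using add_mem hx hy
  | smul r x _ hx => simpa using Submodule.smul_mem _ _ hx
  | mem b hb =>
    obtain ⟨g, k, c, hg, hk, rfl⟩ := hb
    obtain ⟨K, hK⟩ := exists_compact_snd_eq_zero hαφ hg hx
    obtain ⟨L, hL⟩ := exists_compact_forall_fst_eq_self hαφ K hx
    obtain ⟨χ, hχc, hχ1, -⟩ := exists_cutoff L.isCompact
    -- The factor `φ(k)` comes out of the integral on the right and the cutoff `φ(χ)` can be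
    -- inserted on the left, so the integral over `K` is itself a generator of `A₀`.
    have hd (s : G) : α s x * (φ g).fst ((φ k).snd c) = (φ k).snd ((φ g).snd (α s x) * c) := by
      rw [← (φ g).central, ← snd_mul]
    rw [hm.fst_eq_setIntegral μ hα (K₀ := K) fun s hs => by rw [hd, hK s hs, zero_mul, map_zero]]
    refine Submodule.subset_span
      ⟨χ, k, ∫ s in K, (φ g).snd (α s x) * c ∂μ, hχc, hk, ?_⟩
    have hint : IntegrableOn (fun s => (φ g).snd (α s x) * c) K μ :=
      ((((φ g).snd.continuous.comp (hα x)).mul continuous_const).continuousOn).integrableOn_compact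
        K.isCompact
    rw [← (φ k).snd.integral_comp_comm hint, ← (φ χ).fst.integral_comp_comm
      ((φ k).snd.integrable_comp hint)]
    refine setIntegral_congr_fun (measurableSet_compacts K) fun s hs => ?_
    simp only [hd]
    rw [fst_snd_comm, fst_mul, fst_snd_comm, hL χ hχ1 s hs]

include hα in
/-- `E(E(x) b) = E(x) E(b)`. -/
lemma IsStrictAverage.mul {x b : A} {m n : 𝓜(ℂ, A)} (hm : IsStrictAverage μ α x m)
    (hn : IsStrictAverage μ α b n) : IsStrictAverage μ α (m.fst b) (m * n) := by
  have : (fun K : Compacts G => ((∫ s in K, α s (m.fst b) ∂μ : A) : 𝓜(ℂ, A))) =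
      fun K : Compacts G => m * ((∫ s in K, α s b ∂μ : A) : 𝓜(ℂ, A)) := by
    funext K
    simp only [hm.map_fst μ hα]
    rw [mul_coe, m.fst.integral_comp_comm (integrableOn_orbit μ hα b K.isCompact subset_rfl)]
  rw [IsStrictAverage, this]
  exact StrictTendsto.const_mul hn m

lemma star_mem_coreSubspace {x : A} (hx : x ∈ coreSubspace φ) : star x ∈ coreSubspace φ := by
  induction hx using Submodule.span_induction with
  | zero => simp
  | add x y _ _ hx hy => simpa using add_mem hx hy
  | smul r x _ hx => simpa using Submodule.smul_mem _ _ hx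
  | mem x hx =>
    obtain ⟨f, g, a, hf, hg, rfl⟩ := hx
    refine Submodule.subset_span ⟨star g, star f, star a, hasCompactSupport_star hg,
      hasCompactSupport_star hf, ?_⟩
    rw [fst_snd_comm, map_snd_eq_star_fst, map_fst_eq_star_snd φ f]
    simp [map_star]

include hα hφ hαφ in
-- `E(A₀)` is already a `*`-subalgebra, because `E(x) E(y) = E(E(x) y)` with `E(x) y ∈ A₀`;
-- generating an algebra from it adds nothing.
lemma coe_fixAlgebra : (fixAlgebra μ α φ : Set 𝓜(ℂ, A)) = closure (averages μ α φ) := by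
  have hiff {x : A} (hx : x ∈ coreSubspace φ) (m : 𝓜(ℂ, A)) :=
    isAverage_iff_isStrictAverage μ hα hφ hαφ hx (m := m)
  let S : NonUnitalStarSubalgebra ℂ 𝓜(ℂ, A) :=
    { carrier := averages μ α φ
      zero_mem' := ⟨0, zero_mem _, (hiff (zero_mem _) _).2 (by
        simpa using ((hiff (zero_mem _) _).1 (existsUnique_isAverage μ hα hφ hαφ
          (zero_mem (coreSubspace φ))).exists.choose_spec).smul μ 0)⟩
      add_mem' := by
        rintro m n ⟨x, hx, hm⟩ ⟨y, hy, hn⟩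
        exact ⟨x + y, add_mem hx hy, (hiff (add_mem hx hy) _).2
          (((hiff hx m).1 hm).add μ hα ((hiff hy n).1 hn))⟩
      smul_mem' := by
        rintro c m ⟨x, hx, hm⟩
        exact ⟨c • x, Submodule.smul_mem _ c hx, (hiff (Submodule.smul_mem _ c hx) _).2
          (((hiff hx m).1 hm).smul μ c)⟩
      mul_mem' := by
        rintro m n ⟨x, hx, hm⟩ ⟨y, hy, hn⟩
        have hm' := (hiff hx m).1 hm
        have h := hm'.fst_mem_coreSubspace μ hα hαφ hx hy
        exact ⟨_, h, (hiff h _).2 (hm'.mul μ hα ((hiff hy n).1 hn))⟩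
      star_mem' := by
        rintro m ⟨x, hx, hm⟩
        exact ⟨star x, star_mem_coreSubspace hx, (hiff (star_mem_coreSubspace hx) _).2
          (((hiff hx m).1 hm).star μ hα)⟩ }
  have h : NonUnitalStarAlgebra.adjoin ℂ (averages μ α φ) = S :=
    le_antisymm (NonUnitalStarAlgebra.adjoin_le (S := S) subset_rfl)
      (NonUnitalStarAlgebra.subset_adjoin ℂ _)
  rw [fixAlgebra, h]
  rfl

include hα in
-- Each `α_s` is isometric, which upgrades strong continuity to joint continuity.
lemma continuous_apply_of_continuous {y : G → A} (hy : Continuous y) :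
    Continuous fun s => α s (y s) := by
  refine continuous_iff_continuousAt.2 fun r => tendsto_iff_norm_sub_tendsto_zero.2 ?_
  have h1 := tendsto_iff_norm_sub_tendsto_zero.1 (hy.tendsto r)
  have h2 := tendsto_iff_norm_sub_tendsto_zero.1 ((hα (y r)).tendsto r)
  refine squeeze_zero (fun _ => norm_nonneg _) (fun s => ?_) (by simpa using h1.add h2)
  calc ‖α s (y s) - α r (y r)‖ = ‖α s (y s - y r) + (α s (y r) - α r (y r))‖ := by
        rw [map_sub]; abel_nf
    _ ≤ ‖α s (y s - y r)‖ + ‖α s (y r) - α r (y r)‖ := norm_add_le _ _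
    _ = _ := by rw [NonUnitalStarAlgHom.norm_map (α s) (α s).injective]

/-! ### Density of `E(A₀) A₀` in `A₀` -/

section Order

attribute [local instance] CStarAlgebra.spectralOrder CStarAlgebra.spectralOrderedRing

/-- Contractivity of the approximate unit reduces uniform convergence on a compact set to a finite
`ε/3`-net. -/
lemma eventually_forall_norm_mul_sub_le {Q : Set A} (hQ : IsCompact Q) {ε : ℝ} (hε : 0 < ε) :
    ∀ᶠ e in CStarAlgebra.approximateUnit A, ∀ v ∈ Q, ‖e * v - v‖ ≤ ε := by
  have hu := CStarAlgebra.increasingApproximateUnit A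
  obtain ⟨F, -, hF, hcover⟩ := hQ.finite_cover_balls (show 0 < ε / 3 by positivity)
  have h1 : ∀ᶠ e in CStarAlgebra.approximateUnit A, ∀ w ∈ F, ‖e * w - w‖ < ε / 3 := by
    refine (eventually_all_finite hF).2 fun w _ => ?_
    have := (hu.tendsto_mul_right w).eventually
      (Metric.ball_mem_nhds w (show 0 < ε / 3 by positivity))
    simpa [dist_eq_norm] using this
  filter_upwards [h1, hu.eventually_norm] with e he he1 v hv
  obtain ⟨w, hw, hvw⟩ := Set.mem_iUnion₂.1 (hcover hv)
  rw [Metric.mem_ball, dist_eq_norm] at hvw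
  have h3 : ‖e * (v - w)‖ ≤ ε / 3 :=
    (norm_mul_le _ _).trans ((mul_le_of_le_one_left (norm_nonneg _) he1).trans hvw.le)
  calc ‖e * v - v‖ = ‖e * (v - w) + (e * w - w) + -(v - w)‖ := by rw [mul_sub]; abel_nf
    _ ≤ ‖e * (v - w)‖ + ‖e * w - w‖ + ‖-(v - w)‖ := norm_add₃_le
    _ ≤ ε / 3 + ε / 3 + ε / 3 := by
        rw [norm_neg]
        exact add_le_add (add_le_add h3 (he w hw).le) hvw.le
    _ = ε := by ring

include hα hαφ in
-- With `d = φ(g) c` and `v(s) = φ(f) α_s⁻¹(d)`, the left side is `∫ α_s(φ(f) e v(s)) ds` over a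
-- compact set `K` independent of `e`. Since `v(K)` is compact, `e v(s) → v(s)` uniformly on `K`.
lemma tendsto_average_fst {f g : C₀(T, ℂ)} (hf : HasCompactSupport f) (hg : HasCompactSupport g)
    (hfg : ∀ t ∈ tsupport g, ∫ s : G, f (op s • t) * f (op s • t) ∂μ = 1) {m : A → 𝓜(ℂ, A)}
    (hm : ∀ e, IsStrictAverage μ α ((φ f).fst ((φ f).snd e)) (m e)) (c : A) :
    Tendsto (fun e => (m e).fst ((φ g).fst c)) (CStarAlgebra.approximateUnit A)
      (𝓝 ((φ g).fst c)) := by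
  set d := (φ g).fst c with hd
  let K : Compacts G := ⟨_, isCompact_transporter hg hf⟩
  let v : G → A := fun s => (φ f).fst (α s⁻¹ d)
  have hv : Continuous v := (φ f).fst.continuous.comp ((hα d).comp continuous_inv)
  have hinv (s : G) (x : A) : α s (α s⁻¹ x) = x := by
    rw [← StarAlgEquiv.mul_apply, ← map_mul, mul_inv_cancel, map_one, StarAlgEquiv.one_apply]
  have hzero (e : A) : ∀ s ∉ K, α s ((φ f).fst ((φ f).snd e)) * d = 0 := by
    intro s hs
    rw [hd, ← (φ g).central, fst_snd_comm, map_snd hαφ, ← mul_snd_apply, ← map_mul, mul_comm,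
      mul_rt_eq_zero hs, map_zero]
    exact zero_mul c
  have hprod (e : A) (s : G) :
      α s ((φ f).fst ((φ f).snd e)) * d = α s ((φ f).fst (e * v s)) := by
    conv_lhs => rw [← hinv s d, ← map_mul, ← fst_mul, (φ f).central]
  have hint {y : G → A} (hy : Continuous y) :
      IntegrableOn (fun s => α s ((φ f).fst (y s))) K μ :=
    (continuous_apply_of_continuous hα
      ((φ f).fst.continuous.comp hy)).continuousOn.integrableOn_compact K.isCompact
  -- Without `e` the integral is `φ((∫ rt_s(f²) ds) g) c`, and the normalisation of `f` makes the
  -- inner integral `1` on the support of `g`.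
  have hone : ∫ s in K, α s ((φ f).fst (v s)) ∂μ = d := by
    have h1 (s : G) : α s ((φ f).fst (v s)) = (φ (rt s (f * f))).fst d := by
      rw [← mul_fst_apply, ← map_mul, map_fst hαφ, hinv]
    have hff := hasCompactSupport_mul_left hf f
    have hrt := integrableOn_rt μ hff K.isCompact subset_rfl
    let Λ : C₀(T, ℂ) →L[ℂ] A :=
      ⟨{ toFun := fun h => (φ h).fst d
         map_add' := fun x y => by simp [map_add]
         map_smul' := fun r x => by simp [map_smul] },
        (continuous_fst_apply d).comp (continuous_starHom φ)⟩
    simp only [h1]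
    rw [show ∫ s in K, (φ (rt s (f * f))).fst d ∂μ = (φ (∫ s in K, rt s (f * f) ∂μ)).fst d from
      Λ.integral_comp_comm hrt, hd, ← mul_fst_apply, ← map_mul]
    have hone' : (∫ s in (K : Set G), rt s (f * f) ∂μ) * g = g := by
      ext t
      rw [ZeroAtInftyContinuousMap.mul_apply, setIntegral_rt_apply μ hff K.isCompact subset_rfl]
      by_cases ht : t ∈ tsupport g
      · rw [setIntegral_eq_integral_of_forall_compl_eq_zero, show ∫ s : G, (f * f) (op s • t) ∂μ = 1
          from hfg t ht, one_mul]
        intro s hs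
        by_contra hne
        exact hs ⟨t, ht, subset_tsupport _ (left_ne_zero_of_mul hne)⟩
      · rw [image_eq_zero_of_notMem_tsupport ht, mul_zero]
    rw [hone']
  refine Metric.tendsto_nhds.2 fun ε hε => ?_
  have hQ : IsCompact (v '' K) := K.isCompact.image hv
  set δ := ε / (2 * (‖f‖ + 1) * (μ.real K + 1)) with hδ
  have hδ0 : 0 < δ := by positivity
  filter_upwards [eventually_forall_norm_mul_sub_le hQ hδ0] with e he
  rw [dist_eq_norm, (hm e).fst_eq_setIntegral μ hα (hzero e)]
  simp only [hprod]
  rw [← hone]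
  rw [← integral_sub (hint (y := fun s => e * v s) (continuous_const.mul hv)) (hint hv)]
  refine (norm_setIntegral_le_of_norm_le_const (C := ‖f‖ * δ) K.isCompact.measure_lt_top
    fun s hs => ?_).trans_lt ?_
  · rw [← map_sub, ← map_sub, NonUnitalStarAlgHom.norm_map (α s) (α s).injective]
    exact (norm_fst_le _ _).trans (mul_le_mul (NonUnitalStarAlgHom.norm_apply_le φ f)
      (he _ ⟨s, hs, rfl⟩) (norm_nonneg _) (norm_nonneg _))
  · have h0 : 0 ≤ μ.real K := measureReal_nonneg
    calc ‖f‖ * δ * μ.real K ≤ (‖f‖ + 1) * δ * (μ.real K + 1) := by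
          gcongr <;> linarith
      _ = ε / 2 := by rw [hδ]; field_simp
      _ < ε := half_lt_self hε

include hα hφ hαφ in
-- One `f`, normalised over a compact set containing the supports of all left factors of `b`, serves
-- every term of `b` at once. Hence `b` is a limit of single products `E(a) b`, not merely of sums.
lemma coreSubspace_subset_closure : (coreSubspace φ : Set A) ⊆
    closure {x : A | ∃ m ∈ averages μ α φ, ∃ b ∈ coreSubspace φ, x = m.fst b} := by
  intro b hb
  have key : ∃ L : Compacts T, ∀ f : C₀(T, ℂ), HasCompactSupport f →
      (∀ t ∈ L, ∫ s : G, f (op s • t) * f (op s • t) ∂μ = 1) → ∀ m : A → 𝓜(ℂ, A),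
      (∀ e, IsStrictAverage μ α ((φ f).fst ((φ f).snd e)) (m e)) →
      Tendsto (fun e => (m e).fst b) (CStarAlgebra.approximateUnit A) (𝓝 b) := by
    clear hφ
    induction hb using Submodule.span_induction with
    | zero => exact ⟨⊥, fun f _ _ m _ => by simp⟩
    | add x y _ _ hx hy =>
      obtain ⟨L, hL⟩ := hx
      obtain ⟨M, hM⟩ := hy
      refine ⟨L ⊔ M, fun f hf hfL m hm => ?_⟩
      simp only [map_add]
      exact (hL f hf (fun t ht => hfL t (Or.inl ht)) m hm).add
        (hM f hf (fun t ht => hfL t (Or.inr ht)) m hm)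
    | smul c x _ hx =>
      obtain ⟨L, hL⟩ := hx
      refine ⟨L, fun f hf hfL m hm => ?_⟩
      simp only [map_smul]
      exact (hL f hf hfL m hm).const_smul c
    | mem x hx =>
      obtain ⟨g, k, c, hg, hk, rfl⟩ := hx
      exact ⟨⟨tsupport g, hg⟩, fun f hf hfL m hm =>
        tendsto_average_fst μ hα hαφ hf hg hfL hm _⟩
  obtain ⟨L, hL⟩ := key
  obtain ⟨f, hf, hfL⟩ := exists_integral_orbit_eq_one μ L.isCompact
  have hmem (e : A) : (φ f).fst ((φ f).snd e) ∈ coreSubspace φ :=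
    Submodule.subset_span ⟨f, f, e, hf, hf, rfl⟩
  choose m hm using fun e => exists_isStrictAverage μ hα hφ hαφ (hmem e)
  refine mem_closure_of_tendsto (hL f hf hfL m hm) (Eventually.of_forall fun e => ?_)
  exact ⟨m e, ⟨_, hmem e, (isAverage_iff_isStrictAverage μ hα hφ hαφ (hmem e)).2 (hm e)⟩, b, hb,
    rfl⟩

end Order

include hα hφ hαφ in
lemma isNondegenerate_fixInclusion : IsNondegenerate (fixInclusion μ α φ) := by
  refine dense_closure.1 (hφ.dense_coreSubspace.mono
    ((coreSubspace_subset_closure μ hα hφ hαφ).trans (closure_mono ?_)))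
  rintro _ ⟨m, hm, b, -, rfl⟩
  have hmem : m ∈ fixAlgebra μ α φ := by
    rw [← SetLike.mem_coe, coe_fixAlgebra μ hα hφ hαφ]
    exact subset_closure hm
  exact Submodule.subset_span ⟨⟨m, hmem⟩, b, rfl⟩

/-- An element of the idealiser acts on the subalgebra by left and right multiplication, and
associativity is the centralizer identity. Nondegeneracy then identifies the extension of this
multiplier with the given element. -/
lemma range_extension (hι : IsNondegenerate (fixInclusion μ α φ)) :
    Set.range hι.extension = {m : 𝓜(ℂ, A) | ∀ x ∈ fixAlgebra μ α φ,
      m * x ∈ fixAlgebra μ α φ ∧ x * m ∈ fixAlgebra μ α φ} := by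
  ext m
  constructor
  · rintro ⟨n, rfl⟩ x hx
    refine ⟨?_, ?_⟩
    · have h := hι.extension_mul n ⟨x, hx⟩
      exact (show hι.extension n * x = _ from h) ▸ (n.fst ⟨x, hx⟩).2
    · have h := hι.mul_extension n ⟨x, hx⟩
      exact (show x * hι.extension n = _ from h) ▸ (n.snd ⟨x, hx⟩).2
  · intro hm
    let n : 𝓜(ℂ, fixAlgebra μ α φ) :=
      { fst := LinearMap.mkContinuous
          { toFun := fun x => ⟨m * x, (hm x x.2).1⟩
            map_add' := fun x y => Subtype.ext (mul_add m (x : 𝓜(ℂ, A)) y)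
            map_smul' := fun r x => Subtype.ext (mul_smul_comm r m (x : 𝓜(ℂ, A))) } ‖m‖
          fun x => norm_mul_le m (x : 𝓜(ℂ, A))
        snd := LinearMap.mkContinuous
          { toFun := fun x => ⟨x * m, (hm x x.2).2⟩
            map_add' := fun x y => Subtype.ext (add_mul (x : 𝓜(ℂ, A)) y m)
            map_smul' := fun r x => Subtype.ext (smul_mul_assoc r (x : 𝓜(ℂ, A)) m) } ‖m‖
          fun x => (norm_mul_le (x : 𝓜(ℂ, A)) m).trans_eq (mul_comm _ _)
        central := fun x y => Subtype.ext (mul_assoc (x : 𝓜(ℂ, A)) m y) }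
    exact ⟨n, hι.multiplier_ext fun x => by rw [hι.extension_mul]; rfl⟩

end FixedPointAlgebra

end FixedPoint

end

theorem mainTheorem12 {G T A : Type*}
    [Group G] [TopologicalSpace G] [IsTopologicalGroup G] [LocallyCompactSpace G] [T2Space G]
    [MeasurableSpace G] [BorelSpace G]
    (μ : MeasureTheory.Measure G) [μ.IsHaarMeasure] [μ.Regular]
    [TopologicalSpace T] [LocallyCompactSpace T] [T2Space T]
    [MulAction Gᵐᵒᵖ T] [ProperSMul Gᵐᵒᵖ T] [IsCancelSMul Gᵐᵒᵖ T]
    [NonUnitalCStarAlgebra A]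
    (α : G →* (A ≃⋆ₐ[ℂ] A)) (hα : ∀ a : A, Continuous fun s : G => α s a)
    (φ : C₀(T, ℂ) →⋆ₙₐ[ℂ] 𝓜(ℂ, A)) (hφ : FixedPoint.IsNondegenerate φ)
    (hαφ : ∀ (s : G) (f : C₀(T, ℂ)),
      FixedPoint.extendAut (α s) (φ f) = φ (FixedPoint.rt s f)) :
    -- `E(a)` exists and is unique for each `a ∈ A₀`, and `Fix(A, α, φ)` is the closure of `E(A₀)`
    (∀ a ∈ FixedPoint.coreSubspace φ, ∃! m : 𝓜(ℂ, A), FixedPoint.IsAverage μ α a m) ∧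
    (FixedPoint.fixAlgebra μ α φ : Set 𝓜(ℂ, A)) = closure (FixedPoint.averages μ α φ) ∧
    -- `E(A₀) A₀` is contained in `A₀` and dense in it
    (∀ m ∈ FixedPoint.averages μ α φ, ∀ b ∈ FixedPoint.coreSubspace φ,
      m.fst b ∈ FixedPoint.coreSubspace φ) ∧
    (FixedPoint.coreSubspace φ : Set A) ⊆
      closure {x : A | ∃ m ∈ FixedPoint.averages μ α φ, ∃ b ∈ FixedPoint.coreSubspace φ,
        x = m.fst b} ∧
    -- the inclusion of `Fix(A, α, φ)` in `M(A)` is nondegenerate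
    FixedPoint.IsNondegenerate (FixedPoint.fixInclusion μ α φ) ∧
    -- it has a unique extension to `M(Fix(A, α, φ))`, which is strictly continuous, injective, and
    -- has the idealiser of `Fix(A, α, φ)` in `M(A)` as its range
    ∃ Φ : 𝓜(ℂ, FixedPoint.fixAlgebra μ α φ) →⋆ₐ[ℂ] 𝓜(ℂ, A),
      (∀ x : FixedPoint.fixAlgebra μ α φ,
        Φ (x : 𝓜(ℂ, FixedPoint.fixAlgebra μ α φ)) = FixedPoint.fixInclusion μ α φ x) ∧
      (∀ Ψ : 𝓜(ℂ, FixedPoint.fixAlgebra μ α φ) →⋆ₐ[ℂ] 𝓜(ℂ, A),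
        (∀ x : FixedPoint.fixAlgebra μ α φ,
          Ψ (x : 𝓜(ℂ, FixedPoint.fixAlgebra μ α φ)) = FixedPoint.fixInclusion μ α φ x) →
        Ψ = Φ) ∧
      @Continuous _ _ (FixedPoint.strictTopology (FixedPoint.fixAlgebra μ α φ))
        (FixedPoint.strictTopology A) Φ ∧
      Function.Injective Φ ∧
      Set.range Φ = {m : 𝓜(ℂ, A) | ∀ x ∈ FixedPoint.fixAlgebra μ α φ,
        m * x ∈ FixedPoint.fixAlgebra μ α φ ∧ x * m ∈ FixedPoint.fixAlgebra μ α φ} := by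
  have hι := FixedPoint.isNondegenerate_fixInclusion μ hα hφ hαφ
  refine ⟨fun a ha => FixedPoint.existsUnique_isAverage μ hα hφ hαφ ha,
    FixedPoint.coe_fixAlgebra μ hα hφ hαφ, ?_,
    FixedPoint.coreSubspace_subset_closure μ hα hφ hαφ, hι, hι.extension, hι.extension_coe,
    hι.extension_unique, hι.continuous_extension,
    hι.extension_injective Subtype.val_injective, FixedPoint.range_extension μ hι⟩
  rintro m ⟨a, ha, hm⟩ b hb
  exact ((FixedPoint.isAverage_iff_isStrictAverage μ hα hφ hαφ ha).1 hm).fst_mem_coreSubspace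
    μ hα hαφ ha hb
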